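/- Let $L,T>0$, let $\mathcal Z=\mathbb Z^2\setminus\{0\}$, let $|k|$ be the Euclidean length of $k$ and $\mu_k=(2\pi|k|/L)^2$ for $k\in\mathcal Z$. Let $e_k(x)=\omega_{k_1}(x_1)\,\omega_{k_2}(x_2)$ be the real Fourier basis on $[0,L]^2$, where $\omega_j(z)=\sqrt{2/L}\,\sin(2\pi jz/L)$ for $j>0$, $\omega_0=1/\sqrt L$ and $\omega_j(z)=\sqrt{2/L}\,\cos(2\pi jz/L)$ for $j<0$. Let $(\beta_k)_{k\in\mathcal Z}$ be independent standard real Brownian motions on a probability space $\Omega$. Let $(\alpha_k^{(\varepsilon)})_{k\in\mathcal Z,\ \varepsilon>0}$ be real numbers which are bounded uniformly in $k$ and $\varepsilon$, satisfy $\alpha_k^{(\varepsilon)}=O(|k|^{-d(\varepsilon)})$ with some $d(\varepsilon)>0$ for each $\varepsilon>0$, converge to $1$ as $\varepsilon\to0$ for each $k$, and depend on $k$ only through $|k|$. For $\varepsilon>0$ consider the stochastic convolution $$Z_\varepsilon(t,x)=\sum_{k\in\mathcal Z}\alpha_k^{(\varepsilon)}\int_0^te^{-(t-s)\mu_k^2}\,d\beta_k(s)\;e_k(x),\qquad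 t\in[0,T],\ x\in[0,L]^2 .$$ **Theorem.** For every $\varepsilon>0$ the series for $Z_\varepsilon(t,x)$ and the term-by-term differentiated series for $\nabla Z_\varepsilon(t,x)$ converge in $L^2(\Omega)$ at every $(t,x)\in[0,T]\times[0,L]^2$; $Z_\varepsilon$ has a version that is continuous on $[0,T]\times[0,L]^2$ and differentiable in $x$, and whose spatial gradient $\nabla Z_\varepsilon$ is continuous on $[0,T]\times[0,L]^2$ and is a version of the differentiated series. For every $p\in[1,\infty)$ it satisfies $$\nabla Z_\varepsilon\in L^p\big(\Omega,\,C^0([0,T]\times[0,L]^2;\mathbb R^2)\big),$$ and for every $\delta\in(0,1/4)$ there is a constant $C>0$, depending only on $p,\delta,T,L$ (in particular neither on $\varepsilon$ nor on the coefficients $\alpha_k^{(\varepsilon)}$), such that $$\mathbb E\,\|\nabla Z_\varepsilon\|_{C^0}^p\le C\Big(\sum_{k\in\mathcal Z}\big(\alpha_k^{(\varepsilon)}\big)^2\mu_k^{4\delta-1}\Big)^{p/2},$$ where the right-hand side is read as $+\infty$ if the series diverges. -/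

import Mathlib

open MeasureTheory ProbabilityTheory Filter Topology Set
open scoped NNReal ENNReal

noncomputable section

namespace SurfaceGrowth

/-! ### Wiener integrals of deterministic integrands -/

section WienerIntegral

/-- The `n`-th left-point Riemann sum of `∫₀ᵗ f dB` over the uniform partition of `[0,t]`. -/
def wienerSum {Ω : Type*} (B : ℝ≥0 → Ω → ℝ) (f : ℝ≥0 → ℝ) (t : ℝ≥0) (n : ℕ) (ω : Ω) : ℝ :=
  ∑ i ∈ Finset.range n,
    f (t * i / n) * (B (t * (i + 1) / n) ω - B (t * i / n) ω)

/-- `I` is the Wiener integral `∫₀ᵗ f dB` of the continuous deterministic function `f`: the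
limit in `L²(Ω)` of the Riemann sums. It is unique up to almost sure equality. -/
def HasWienerIntegral {Ω : Type*} [MeasurableSpace Ω] (P : Measure Ω) (B : ℝ≥0 → Ω → ℝ)
    (f : ℝ≥0 → ℝ) (t : ℝ≥0) (I : Ω → ℝ) : Prop :=
  MemLp I 2 P ∧
    Tendsto (fun n : ℕ => eLpNorm (fun ω => wienerSum B f t n ω - I ω) 2 P) atTop (𝓝 0)

open Classical in
/-- The Wiener integral `∫₀ᵗ f dB` of a continuous deterministic function `f`, as a random
variable (a representative of its almost sure class). -/
def wienerIntegral {Ω : Type*} [MeasurableSpace Ω] (P : Measure Ω) (B : ℝ≥0 → Ω → ℝ)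
    (f : ℝ≥0 → ℝ) (t : ℝ≥0) : Ω → ℝ :=
  if h : ∃ I : Ω → ℝ, HasWienerIntegral P B f t I then h.choose else 0

/-- The indicator of `(0,s]` in `L²(ℝ)`. -/
def indL2 (s : ℝ≥0) : Lp ℝ 2 (volume : Measure ℝ) :=
  indicatorConstLp 2 (measurableSet_Ioc (a := (0 : ℝ)) (b := s)) measure_Ioc_lt_top.ne 1

theorem inner_indL2 (s t : ℝ≥0) : inner ℝ (indL2 s) (indL2 t) = ((min s t : ℝ≥0) : ℝ) := by
  rw [indL2, indL2, L2.inner_indicatorConstLp_indicatorConstLp _ _ measure_Ioc_lt_top.ne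
    measure_Ioc_lt_top.ne, Ioc_inter_Ioc, max_self, Measure.real, Real.volume_Ioc]
  rw [sub_zero, ENNReal.toReal_ofReal (by positivity), NNReal.coe_min]
  simp

/-- The step function with values `f (t i / n)` on `(t i / n, t (i+1) / n]`. -/
theorem coeFn_step (f : ℝ≥0 → ℝ) (t : ℝ≥0) (n : ℕ) :
    ((∑ i ∈ Finset.range n, f (t * i / n) • (indL2 (t * (i + 1) / n) - indL2 (t * i / n)) :
      Lp ℝ 2 (volume : Measure ℝ)) : ℝ → ℝ) =ᵐ[volume] fun s => ∑ i ∈ Finset.range n,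
        (Ioc ((t * i / n : ℝ≥0) : ℝ) ((t * (i + 1) / n : ℝ≥0) : ℝ)).indicator
          (fun _ => f (t * i / n)) s := by
  have h1 := Lp.coeFn_finsetSum (Finset.range n) (fun i : ℕ => f (t * i / n) •
    (indL2 (t * (i + 1) / n) - indL2 (t * i / n)))
  refine h1.trans ?_
  have h2 : ∀ i : ℕ, ∀ᵐ s : ℝ, (f (t * i / n) •
      (indL2 (t * (i + 1) / n) - indL2 (t * i / n)) : Lp ℝ 2 (volume : Measure ℝ)) s =
      (Ioc ((t * i / n : ℝ≥0) : ℝ) ((t * (i + 1) / n : ℝ≥0) : ℝ)).indicator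
          (fun _ => f (t * i / n)) s := by
    intro i
    filter_upwards [Lp.coeFn_smul (f (t * i / n)) (indL2 (t * (i + 1) / n) - indL2 (t * i / n)),
      Lp.coeFn_sub (indL2 (t * (i + 1) / n)) (indL2 (t * i / n)),
      indicatorConstLp_coeFn (p := 2) (μ := (volume : Measure ℝ)) (c := (1 : ℝ))
        (hs := measurableSet_Ioc (a := (0 : ℝ)) (b := (t * i / n : ℝ≥0)))
        (hμs := measure_Ioc_lt_top.ne),
      indicatorConstLp_coeFn (p := 2) (μ := (volume : Measure ℝ)) (c := (1 : ℝ))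
        (hs := measurableSet_Ioc (a := (0 : ℝ)) (b := (t * (i + 1) / n : ℝ≥0)))
        (hμs := measure_Ioc_lt_top.ne)] with s a1 a2 a3 a4
    rw [a1, Pi.smul_apply, a2, Pi.sub_apply, indL2, indL2, a3, a4]
    have hle : ((t * i / n : ℝ≥0) : ℝ) ≤ ((t * (i + 1) / n : ℝ≥0) : ℝ) := by
      have : (t * i / n : ℝ≥0) ≤ t * (i + 1) / n := by gcongr; simp
      exact_mod_cast this
    have h0 : (0 : ℝ) ≤ ((t * i / n : ℝ≥0) : ℝ) := NNReal.coe_nonneg _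
    generalize ((t * i / n : ℝ≥0) : ℝ) = a at *
    generalize ((t * (i + 1) / n : ℝ≥0) : ℝ) = b at *
    simp only [indicator, mem_Ioc, smul_eq_mul]
    split_ifs <;> grind
  have h3 := ae_all_iff.2 h2
  filter_upwards [h3] with s hs
  simp only [Finset.sum_apply, hs]

theorem step_apply (f : ℝ≥0 → ℝ) (t : ℝ≥0) (n : ℕ) (s : ℝ) (hs : s ∈ Ioc (0 : ℝ) t) (hn : 0 < n) :
    ∃ r : ℝ≥0, r ≤ t ∧ |(r : ℝ) - s| ≤ t / n ∧ ∑ i ∈ Finset.range n,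
      (Ioc ((t * i / n : ℝ≥0) : ℝ) ((t * (i + 1) / n : ℝ≥0) : ℝ)).indicator
          (fun _ => f (t * i / n)) s = f r := by
  have ht : (0 : ℝ) < t := hs.1.trans_le hs.2
  have hn' : (0 : ℝ) < n := by exact_mod_cast hn
  have hmem : ∀ i : ℕ, s ∈ Ioc ((t * i / n : ℝ≥0) : ℝ) ((t * (i + 1) / n : ℝ≥0) : ℝ) ↔
      ⌈s * n / t⌉₊ = i + 1 := by
    intro i
    rw [Nat.ceil_eq_iff (by omega), mem_Ioc]
    push_cast
    rw [div_lt_iff₀ hn', le_div_iff₀ hn', lt_div_iff₀ ht, div_le_iff₀ ht]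
    constructor <;> rintro ⟨h1, h2⟩ <;> constructor <;> linarith
  have hpos : 0 < ⌈s * n / t⌉₊ := Nat.ceil_pos.2 (by have := hs.1; positivity)
  have hle : ⌈s * n / t⌉₊ ≤ n := by
    refine Nat.ceil_le.2 ?_
    rw [div_le_iff₀ ht]
    have := hs.2
    nlinarith
  obtain ⟨j, hj⟩ : ∃ j, ⌈s * n / t⌉₊ = j + 1 := ⟨⌈s * n / t⌉₊ - 1, by omega⟩
  have hjm := (hmem j).2 hj
  refine ⟨t * j / n, ?_, ?_, ?_⟩
  · rw [div_le_iff₀ (by exact_mod_cast hn)]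
    gcongr
    omega
  · rw [abs_sub_comm, abs_of_nonneg (by linarith [hjm.1])]
    have := hjm.2
    push_cast at this ⊢
    have e : (t : ℝ) * (j + 1) / n = t * j / n + t / n := by ring
    linarith
  · rw [Finset.sum_eq_single j]
    · rw [indicator_of_mem hjm]
    · intro i _ hij
      rw [indicator_of_notMem]
      rw [hmem]
      omega
    · intro h
      simp at h
      omega

theorem step_apply_zero (f : ℝ≥0 → ℝ) (t : ℝ≥0) (n : ℕ) (s : ℝ) (hs : s ∉ Ioc (0 : ℝ) t) :
    ∑ i ∈ Finset.range n,
      (Ioc ((t * i / n : ℝ≥0) : ℝ) ((t * (i + 1) / n : ℝ≥0) : ℝ)).indicator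
          (fun _ => f (t * i / n)) s = 0 := by
  refine Finset.sum_eq_zero fun i hi => indicator_of_notMem (fun h => hs ⟨?_, ?_⟩) _
  · exact (NNReal.coe_nonneg _).trans_lt h.1
  · refine h.2.trans ?_
    have : (t * (i + 1) / n : ℝ≥0) ≤ t := by
      have hi' : i < n := Finset.mem_range.1 hi
      rw [div_le_iff₀ (by exact_mod_cast (by omega : 0 < n))]
      gcongr
      exact_mod_cast hi'
    exact_mod_cast this

theorem cauchySeq_step (f : ℝ≥0 → ℝ) (hf : Continuous f) (t : ℝ≥0) :
    CauchySeq (fun n : ℕ =>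
      (∑ i ∈ Finset.range n, f (t * i / n) • (indL2 (t * (i + 1) / n) - indL2 (t * i / n)) :
      Lp ℝ 2 (volume : Measure ℝ))) := by
  have hu : UniformContinuousOn f (Icc 0 t) :=
    isCompact_Icc.uniformContinuousOn_of_continuous hf.continuousOn
  rw [Metric.cauchySeq_iff]
  intro ε hε
  obtain ⟨η, hη, hηε⟩ : ∃ η : ℝ, 0 < η ∧ η * (t + 1) < ε :=
    ⟨ε / (2 * (t + 1)), by positivity, by
      have : (0 : ℝ) < t + 1 := by positivity
      field_simp
      linarith⟩
  obtain ⟨d, hd, hd'⟩ := Metric.uniformContinuousOn_iff.1 hu η hη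
  obtain ⟨N, hN⟩ := exists_nat_gt (2 * t / d : ℝ)
  have key : ∀ n ≥ N + 1, (t : ℝ) / n < d / 2 := by
    intro n hn
    have hn0 : (0 : ℝ) < n := by exact_mod_cast (by omega : 0 < n)
    have : (N : ℝ) ≤ n := by exact_mod_cast (by omega : N ≤ n)
    have h1 : 2 * t / d < (n : ℝ) := hN.trans_le this
    rw [div_lt_iff₀ hd] at h1
    rw [div_lt_iff₀ hn0]
    linarith
  refine ⟨N + 1, fun m hm n hn => ?_⟩
  have key_m := key m hm
  have key_n := key n hn
  rw [dist_eq_norm]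
  set V := fun n : ℕ => (∑ i ∈ Finset.range n, f (t * i / n) •
    (indL2 (t * (i + 1) / n) - indL2 (t * i / n)) : Lp ℝ 2 (volume : Measure ℝ)) with hV
  change ‖V m - V n‖ < ε
  have hb : ∀ᵐ s : ℝ, ‖(V m - V n : Lp ℝ 2 (volume : Measure ℝ)) s‖ ≤
      ‖(indicatorConstLp 2 (measurableSet_Ioc (a := (0 : ℝ)) (b := t)) measure_Ioc_lt_top.ne η :
        Lp ℝ 2 (volume : Measure ℝ)) s‖ := by
    filter_upwards [Lp.coeFn_sub (V m) (V n), coeFn_step f t m, coeFn_step f t n,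
      indicatorConstLp_coeFn (p := 2) (μ := (volume : Measure ℝ)) (c := η)
        (hs := measurableSet_Ioc (a := (0 : ℝ)) (b := t))
        (hμs := measure_Ioc_lt_top.ne)] with s a1 a2 a3 a4
    rw [a1, Pi.sub_apply, a2, a3, a4]
    by_cases hs : s ∈ Ioc (0 : ℝ) t
    · obtain ⟨r, hr, hrs, hre⟩ := step_apply f t m s hs (by omega)
      obtain ⟨q, hq, hqs, hqe⟩ := step_apply f t n s hs (by omega)
      rw [hre, hqe, indicator_of_mem hs, ← dist_eq_norm]
      have : dist (f r) (f q) < η := by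
        refine hd' r ⟨zero_le, hr⟩ q ⟨zero_le, hq⟩ ?_
        rw [NNReal.dist_eq]
        have := abs_sub_le (r : ℝ) s q
        rw [abs_sub_comm s] at this
        linarith
      exact this.le.trans (le_abs_self η)
    · rw [step_apply_zero _ _ _ _ hs, step_apply_zero _ _ _ _ hs]
      simp
  refine (Lp.norm_le_norm_of_ae_le hb).trans_lt ?_
  rw [norm_indicatorConstLp (by norm_num) (by norm_num)]
  refine lt_of_le_of_lt ?_ hηε
  simp only [Measure.real, Real.volume_Ioc, sub_zero, ENNReal.ofReal_coe_nnreal, ENNReal.coe_toReal,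
    Real.norm_of_nonneg hη.le, ENNReal.toReal_ofNat]
  gcongr
  rw [← Real.sqrt_eq_rpow, Real.sqrt_le_left (by positivity)]
  nlinarith [t.2]

/-- The Riemann sums converge: the Wiener integral of a continuous deterministic function
against a Brownian motion exists. -/
theorem hasWienerIntegral_wienerIntegral {Ω : Type*} [MeasurableSpace Ω] {P : Measure Ω}
    [IsProbabilityMeasure P] {B : ℝ≥0 → Ω → ℝ} (hB : IsBrownianReal B P)
    {f : ℝ≥0 → ℝ} (hf : Continuous f) (t : ℝ≥0) :
    HasWienerIntegral P B f t (wienerIntegral P B f t) := by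
  have hm : ∀ s, MemLp (B s) 2 P := fun s =>
    (hB.isGaussianProcess.hasGaussianLaw_eval s).memLp_two
  let b : ℝ≥0 → Lp ℝ 2 P := fun s => (hm s).toLp
  have hb : ∀ s u, inner ℝ (b s) (b u) = inner ℝ (indL2 s) (indL2 u) := by
    intro s u
    rw [inner_indL2, ← hB.covariance_eval s u, covariance_eq_sub (hm s) (hm u), hB.integral_eval,
      zero_mul, sub_zero, L2.inner_def]
    refine integral_congr_ae ?_
    filter_upwards [(hm s).coeFn_toLp, (hm u).coeFn_toLp] with ω h1 h2
    simp only [b]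
    rw [h1, h2]
    simp [mul_comm]
  let S : ℕ → Lp ℝ 2 P := fun n =>
    ∑ i ∈ Finset.range n, f (t * i / n) • (b (t * (i + 1) / n) - b (t * i / n))
  let V : ℕ → Lp ℝ 2 (volume : Measure ℝ) := fun n =>
    ∑ i ∈ Finset.range n, f (t * i / n) • (indL2 (t * (i + 1) / n) - indL2 (t * i / n))
  have hSV : ∀ m n, inner ℝ (S m) (S n) = inner ℝ (V m) (V n) := by
    intro m n
    simp only [S, V, sum_inner, inner_sum, inner_smul_left, inner_smul_right, inner_sub_left,
      inner_sub_right, hb]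
  have hdist : ∀ m n, dist (S m) (S n) = dist (V m) (V n) := by
    intro m n
    rw [dist_eq_norm, dist_eq_norm, ← sq_eq_sq₀ (norm_nonneg _) (norm_nonneg _),
      ← real_inner_self_eq_norm_sq, ← real_inner_self_eq_norm_sq]
    simp only [inner_sub_left, inner_sub_right, hSV]
  have hc : CauchySeq S := by
    have hV := Metric.cauchySeq_iff.1 (cauchySeq_step f hf t)
    rw [Metric.cauchySeq_iff]
    intro ε hε
    obtain ⟨N, hN⟩ := hV ε hε
    exact ⟨N, fun m hm n hn => by rw [hdist]; exact hN m hm n hn⟩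
  obtain ⟨x, hx⟩ := cauchySeq_tendsto_of_complete hc
  have hex : ∃ I : Ω → ℝ, HasWienerIntegral P B f t I := by
    refine ⟨x, Lp.memLp x, ?_⟩
    rw [← Lp.toLp_coeFn x (Lp.memLp x), Lp.tendsto_Lp_iff_tendsto_eLpNorm] at hx
    refine hx.congr fun n => eLpNorm_congr_ae ?_
    have h1 : (S n : Ω → ℝ) =ᵐ[P] fun ω => wienerSum B f t n ω := by
      have h2 := Lp.coeFn_finsetSum (Finset.range n) (fun i : ℕ => f (t * i / n) •
        (b (t * (i + 1) / n) - b (t * i / n)))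
      refine h2.trans ?_
      have h3 : ∀ i : ℕ, ∀ᵐ ω ∂P, (f (t * i / n) •
          (b (t * (i + 1) / n) - b (t * i / n)) : Lp ℝ 2 P) ω =
          f (t * i / n) * (B (t * (i + 1) / n) ω - B (t * i / n) ω) := by
        intro i
        filter_upwards [Lp.coeFn_smul (f (t * i / n)) (b (t * (i + 1) / n) - b (t * i / n)),
          Lp.coeFn_sub (b (t * (i + 1) / n)) (b (t * i / n)),
          (hm (t * (i + 1) / n)).coeFn_toLp, (hm (t * i / n)).coeFn_toLp] with ω a1 a2 a3 a4
        rw [a1, Pi.smul_apply, a2, Pi.sub_apply, a3, a4, smul_eq_mul]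
      filter_upwards [ae_all_iff.2 h3] with ω hω
      simp only [Finset.sum_apply, hω, wienerSum]
    filter_upwards [h1] with ω hω
    rw [Pi.sub_apply, hω]
  rw [wienerIntegral, dif_pos hex]
  exact hex.choose_spec
end WienerIntegral

/-! ### Convergent random series -/

/-- The random series `∑ i, X i` converges (unconditionally) in `L²(Ω; E)` and `Y` is its sum. -/
def HasL2Sum {Ω ι E : Type*} [MeasurableSpace Ω] [NormedAddCommGroup E] (P : Measure Ω)
    (X : ι → Ω → E) (Y : Ω → E) : Prop :=
  (∀ i, MemLp (X i) 2 P) ∧ MemLp Y 2 P ∧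
    Tendsto (fun s : Finset ι => eLpNorm (fun ω => (∑ i ∈ s, X i ω) - Y ω) 2 P) atTop (𝓝 0)

/-! ### The Fourier basis of the square -/

/-- The plane with its Euclidean norm. -/
abbrev Plane : Type := EuclideanSpace ℝ (Fin 2)

/-- The nonzero frequencies `ℤ² \ {0}`. -/
abbrev Freq : Type := {k : ℤ × ℤ // k ≠ 0}

/-- The Euclidean length `|k|`. -/
def freqNorm (k : Freq) : ℝ := √((k.1.1 : ℝ) ^ 2 + (k.1.2 : ℝ) ^ 2)

/-- The eigenvalue `μ_k = (2π|k|/L)²` of `-Δ`. -/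
def eigenvalue (L : ℝ) (k : Freq) : ℝ := (2 * Real.pi * freqNorm k / L) ^ 2

/-- The one-dimensional real Fourier basis of `L²([0,L])`. -/
def basis1D (L : ℝ) (j : ℤ) (z : ℝ) : ℝ :=
  if 0 < j then √(2 / L) * Real.sin (2 * Real.pi * j / L * z)
  else if j = 0 then 1 / √L
  else √(2 / L) * Real.cos (2 * Real.pi * j / L * z)

/-- The basis function `e_k(x) = ω_{k₁}(x₁) ω_{k₂}(x₂)`. -/
def basis2D (L : ℝ) (k : Freq) (x : Plane) : ℝ :=
  basis1D L k.1.1 (x 0) * basis1D L k.1.2 (x 1)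

/-- The square `[0,L]²`. -/
def square (L : ℝ) : Set Plane := {x | ∀ i, x i ∈ Icc (0 : ℝ) L}

/-- The compact space-time domain `[0,T] × [0,L]²`. -/
abbrev SpaceTime (T L : ℝ) : Type := Icc (0 : ℝ) T × Icc (0 : ℝ) L × Icc (0 : ℝ) L

/-- The time coordinate of a space-time point. -/
def SpaceTime.time {T L : ℝ} (q : SpaceTime T L) : ℝ := q.1

/-- The spatial coordinate of a space-time point. -/
def SpaceTime.pos {T L : ℝ} (q : SpaceTime T L) : Plane := !₂[(q.2.1 : ℝ), (q.2.2 : ℝ)]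

/-! ### The regularized stochastic convolution -/

/-- The regularizing coefficients `α_k^{(ε)}`, `ε > 0`: uniformly bounded, of order
`O(|k|^{-d(ε)})` with some `d(ε) > 0` for each `ε`, converging to `1` as `ε → 0`, and radially
symmetric. -/
structure IsNoiseRegularization (α : ℝ → Freq → ℝ) : Prop where
  bounded : ∃ M : ℝ, ∀ ε : ℝ, 0 < ε → ∀ k, |α ε k| ≤ M
  decay : ∀ ε : ℝ, 0 < ε → ∃ d : ℝ, 0 < d ∧ ∃ K : ℝ, ∀ k, |α ε k| ≤ K * freqNorm k ^ (-d)
  tendsto_one : ∀ k, Tendsto (fun ε => α ε k) (𝓝[>] 0) (𝓝 1)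
  radial : ∀ ε : ℝ, 0 < ε → ∀ k l, freqNorm k = freqNorm l → α ε k = α ε l

/-- `Z_k(t) = ∫₀ᵗ exp(-(t-s) μ_k²) dβ_k(s)`. -/
def modeConvolution {Ω : Type*} [MeasurableSpace Ω] (P : Measure Ω) (β : Freq → ℝ≥0 → Ω → ℝ)
    (L : ℝ) (k : Freq) (t : ℝ≥0) : Ω → ℝ :=
  wienerIntegral P (β k) (fun s => Real.exp (-((t : ℝ) - s) * eigenvalue L k ^ 2)) t

/-- `Z` is a version on `[0,T] × [0,L]²` of the stochastic convolution
`∑_k a_k Z_k(t) e_k(x)` that is continuous in space-time and differentiable in space, and `G`,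
continuous in space-time, is its spatial gradient. At every space-time point `G` is at the same
time a version of the term-by-term differentiated series `∑_k a_k Z_k(t) ∇e_k(x)`. -/
structure IsGradientVersion {Ω : Type*} [MeasurableSpace Ω] (P : Measure Ω)
    (β : Freq → ℝ≥0 → Ω → ℝ) (a : Freq → ℝ) (T L : ℝ)
    (Z : ℝ → Plane → Ω → ℝ) (G : Ω → C(SpaceTime T L, Plane)) : Prop where
  hasL2Sum : ∀ t ∈ Icc (0 : ℝ) T, ∀ x ∈ square L,
    HasL2Sum P (fun k ω => a k * modeConvolution P β L k t.toNNReal ω * basis2D L k x) (Z t x)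
  continuousOn : ∀ ω, ContinuousOn (fun q : ℝ × Plane => Z q.1 q.2 ω) (Icc 0 T ×ˢ square L)
  hasGradient : ∀ ω, ∀ q : SpaceTime T L,
    HasGradientWithinAt (fun y => Z q.time y ω) (G ω q) (square L) q.pos
  hasL2Sum_gradient : ∀ q : SpaceTime T L,
    HasL2Sum P
      (fun k ω => (a k * modeConvolution P β L k q.time.toNNReal ω) •
        gradient (basis2D L k) q.pos)
      (fun ω => G ω q)

end SurfaceGrowth

end

noncomputable section

namespace SurfaceGrowth

/-! The field consisting of the convolution and its two partial derivatives is treated as a single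
random element of C(K), where K is space-time times a three-point set indexing the components.
Everything rests on one bound for finite partial sums (`exists_field_bound`): the L^p norm of the
supremum of the sum over a finite set F of modes is at most C times the square root of the sum over
F of α_k² μ_k^(4δ-1), with C independent of F and of the coefficients.

The Wiener isometry gives the covariances explicitly: distinct modes are orthogonal, and Z_k has
variance of order μ_k^(-2). A derivative of e_k contributes |k|², comparable to μ_k, so each mode of
the gradient has variance of order at most μ_k^(-1). Paying the factor μ_k^(4δ) buys Hölder
continuity of order δ in time and space, because 1 - exp(-μ_k² h) ≤ (μ_k² h)^(2δ)
(`exists_jet_variance_bound`). Gaussianity upgrades L² bounds to L^r bounds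
(`exists_mode_moment_bound`), and dyadic chaining in three dimensions bounds the supremum once rδ >
3 (`exists_sup_bound`); small exponents follow by monotonicity of the norms.

The decay of the coefficients makes the weighted sum finite for some δ₀. The same bound, applied to
finite sets of modes far out in the series, shows that it is summable in the complete space L²(Ω;
C(K)) (`exists_field`). A subsequence of partial sums converges uniformly almost surely, and uniform
convergence of functions together with their gradients preserves differentiability
(`isJet_of_tendsto`). By Fatou, the bound for every p and every δ passes to this one limit, so the
version depends on neither. -/

/-! ### Chaining -/

/-- The chaining bound for the supremum of a random continuous function. -/
theorem eLpNorm'_le_chaining {Ω K : Type*} [MeasurableSpace Ω] {P : Measure Ω}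
    [TopologicalSpace K] [CompactSpace K] {ι : ℕ → Type} [∀ n, Fintype (ι n)]
    (g : ∀ n, ι n → K) (π : ∀ n, ι (n + 1) → ι n)
    (hdense : ∀ x : K, ∃ i : ∀ n, ι n, Tendsto (fun n => g n (i n)) atTop (𝓝 x))
    {f : Ω → C(K, ℝ)} (hf : ∀ x, AEMeasurable (fun ω => f ω x) P) {p : ℝ} (hp : 1 ≤ p)
    {M : ℝ≥0∞} {A : ℕ → ℝ≥0∞}
    (h0 : ∀ i : ι 0, eLpNorm' (fun ω => f ω (g 0 i)) p P ≤ M)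
    (hinc : ∀ n, ∀ i : ι (n + 1),
      eLpNorm' (fun ω => f ω (g (n + 1) i) - f ω (g n (π n i))) p P ≤ A n) :
    eLpNorm' f p P ≤ (Fintype.card (ι 0) : ℝ≥0∞) ^ (1 / p) * M +
      ∑' n, (Fintype.card (ι (n + 1)) : ℝ≥0∞) ^ (1 / p) * A n := by
  have hp0 : 0 < p := by linarith
  -- A finite maximum is at most the ℓ^p sum, so taking the maximum over a level costs only the p-th
  -- root of its cardinality.
  have hmax : ∀ {J : Type} [Fintype J] (v : J → Ω → ℝ), (∀ j, AEMeasurable (v j) P) →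
      ∀ B : ℝ≥0∞, (∀ j, eLpNorm' (v j) p P ≤ B) →
      (∫⁻ ω, (⨆ j, ‖v j ω‖ₑ) ^ p ∂P) ^ (1 / p) ≤ (Fintype.card J : ℝ≥0∞) ^ (1 / p) * B := by
    intro J _ v hv B hB
    rw [one_div, ENNReal.rpow_inv_le_iff hp0, ENNReal.mul_rpow_of_nonneg _ _ hp0.le,
      ← ENNReal.rpow_mul, inv_mul_cancel₀ hp0.ne', ENNReal.rpow_one]
    calc ∫⁻ ω, (⨆ j, ‖v j ω‖ₑ) ^ p ∂P ≤ ∫⁻ ω, ∑ j, ‖v j ω‖ₑ ^ p ∂P := by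
          refine lintegral_mono fun ω => ?_
          rw [← ENNReal.le_rpow_inv_iff hp0]
          refine iSup_le fun j => ?_
          rw [ENNReal.le_rpow_inv_iff hp0]
          exact Finset.single_le_sum (f := fun j => ‖v j ω‖ₑ ^ p) (fun _ _ => zero_le)
            (Finset.mem_univ j)
      _ = ∑ j, ∫⁻ ω, ‖v j ω‖ₑ ^ p ∂P :=
          lintegral_finsetSum' _ fun j _ => ((hv j).enorm.pow_const p)
      _ ≤ ∑ _j : J, B ^ p := by
          refine Finset.sum_le_sum fun j _ => ?_
          have := hB j
          rwa [eLpNorm', one_div, ENNReal.rpow_inv_le_iff hp0] at this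
      _ = _ := by simp
  set U : ∀ n : ℕ, Ω → ℝ≥0∞ := fun n ω => ⨆ i, ‖f ω (g n i)‖ₑ with hU
  have hUm : ∀ n, AEMeasurable (U n) P := fun n => AEMeasurable.iSup fun i => (hf _).enorm
  have hstep : ∀ n, (∫⁻ ω, U n ω ^ p ∂P) ^ (1 / p) ≤ (Fintype.card (ι 0) : ℝ≥0∞) ^ (1 / p) * M +
      ∑ m ∈ Finset.range n, (Fintype.card (ι (m + 1)) : ℝ≥0∞) ^ (1 / p) * A m := by
    intro n
    induction n with
    | zero =>
      simpa using hmax (fun i ω => f ω (g 0 i)) (fun i => hf _) M h0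
    | succ n ih =>
      set R : Ω → ℝ≥0∞ := fun ω => ⨆ i, ‖f ω (g (n + 1) i) - f ω (g n (π n i))‖ₑ with hR
      have hRm : AEMeasurable R P := AEMeasurable.iSup fun i => ((hf _).sub (hf _)).enorm
      have h1 : ∀ ω, U (n + 1) ω ≤ U n ω + R ω := by
        intro ω
        refine iSup_le fun i => ?_
        have e : f ω (g (n + 1) i) =
          f ω (g n (π n i)) + (f ω (g (n + 1) i) - f ω (g n (π n i))) := by ring
        calc ‖f ω (g (n + 1) i)‖ₑ ≤ ‖f ω (g n (π n i))‖ₑ +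
              ‖f ω (g (n + 1) i) - f ω (g n (π n i))‖ₑ := by
              conv_lhs => rw [e]
              exact enorm_add_le _ _
          _ ≤ _ := add_le_add (le_iSup (fun j => ‖f ω (g n j)‖ₑ) (π n i))
              (le_iSup (fun i => ‖f ω (g (n + 1) i) - f ω (g n (π n i))‖ₑ) i)
      rw [Finset.sum_range_succ, ← add_assoc]
      calc (∫⁻ ω, U (n + 1) ω ^ p ∂P) ^ (1 / p) ≤ (∫⁻ ω, (U n + R) ω ^ p ∂P) ^ (1 / p) := by
            gcongr with ω
            exact h1 ω
        _ ≤ (∫⁻ ω, U n ω ^ p ∂P) ^ (1 / p) + (∫⁻ ω, R ω ^ p ∂P) ^ (1 / p) :=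
            ENNReal.lintegral_Lp_add_le (hUm n) hRm hp
        _ ≤ _ := add_le_add ih (hmax (fun i ω => f ω (g (n + 1) i) - f ω (g n (π n i)))
            (fun i => (hf _).sub (hf _)) _ (hinc n))
  rw [eLpNorm', one_div, ENNReal.rpow_inv_le_iff hp0, ← one_div]
  -- The levels need not be nested, so the supremum is reached as a lower limit of the level maxima,
  -- along grid points tending to an almost maximal point. Fatou's lemma then applies.
  have hlim : ∀ ω, ‖f ω‖ₑ ^ p ≤ liminf (fun n => U n ω ^ p) atTop := by
    intro ω
    have h2 : ‖f ω‖ₑ ≤ (liminf (fun n => U n ω ^ p) atTop) ^ (1 / p) := by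
      refine ENNReal.le_of_forall_nnreal_lt fun r hr => ?_
      rw [← ofReal_norm, ENNReal.lt_ofReal_iff_toReal_lt (by simp)] at hr
      obtain ⟨x, hx⟩ : ∃ x, (r : ℝ) ≤ ‖f ω x‖ := by
        by_contra! hcon
        exact absurd (((f ω).norm_le (r.2)).2 fun x => (hcon x).le) (not_le.2 hr)
      obtain ⟨i, hi⟩ := hdense x
      have h3 : Tendsto (fun n => ‖f ω (g n (i n))‖ₑ ^ p) atTop (𝓝 (‖f ω x‖ₑ ^ p)) :=
        (((f ω).continuous.tendsto x).comp hi).enorm.ennrpow_const p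
      rw [one_div, ENNReal.le_rpow_inv_iff hp0]
      calc (r : ℝ≥0∞) ^ p ≤ ‖f ω x‖ₑ ^ p := by
            gcongr
            rw [← ofReal_norm, ← ENNReal.ofReal_coe_nnreal]
            exact ENNReal.ofReal_le_ofReal hx
        _ = liminf (fun n => ‖f ω (g n (i n))‖ₑ ^ p) atTop := h3.liminf_eq.symm
        _ ≤ _ := by
            refine liminf_le_liminf (Eventually.of_forall fun n => ?_)
            gcongr
            exact le_iSup (fun j => ‖f ω (g n j)‖ₑ) (i n)
    rwa [one_div, ENNReal.le_rpow_inv_iff hp0] at h2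
  calc ∫⁻ ω, ‖f ω‖ₑ ^ p ∂P ≤ ∫⁻ ω, liminf (fun n => U n ω ^ p) atTop ∂P := lintegral_mono hlim
    _ ≤ liminf (fun n => ∫⁻ ω, U n ω ^ p ∂P) atTop :=
        lintegral_liminf_le' fun n => (hUm n).pow_const p
    _ ≤ _ := by
        refine liminf_le_of_le (by isBoundedDefault) fun b hb => ?_
        obtain ⟨n, hn⟩ := hb.exists
        refine hn.trans ?_
        rw [← ENNReal.rpow_inv_le_iff hp0, ← one_div]
        refine (hstep n).trans ?_
        gcongr
        exact ENNReal.sum_le_tsum _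

/-- A random continuous function with measurable evaluations is measurable. -/
theorem aestronglyMeasurable_continuousMap {Ω K : Type*} [MeasurableSpace Ω] {P : Measure Ω}
    [TopologicalSpace K] [CompactSpace K] [SecondCountableTopology K] [T2Space K] [Nonempty K]
    {f : Ω → C(K, ℝ)}
    (hf : ∀ x, AEMeasurable (fun ω => f ω x) P) : AEStronglyMeasurable f P := by
  let _ : MetricSpace K := TopologicalSpace.metrizableSpaceMetric K
  borelize C(K, ℝ)
  let e : C(K, ℝ) → (ℕ → ℝ) := fun h n => h (TopologicalSpace.denseSeq K n)
  -- Evaluation along a dense sequence is a continuous injection of a Polish space, hence a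
  -- measurable embedding by Lusin–Souslin.
  have he : MeasurableEmbedding e := by
    refine Continuous.measurableEmbedding
      (continuous_pi fun n => continuous_eval_const _) fun h h' hh => ?_
    refine ContinuousMap.ext fun x => ?_
    exact congrFun ((TopologicalSpace.denseRange_denseSeq K).equalizer h.continuous h'.continuous
      hh) x
  have h1 : AEMeasurable (e ∘ f) P := aemeasurable_pi_lambda _ fun n => hf _
  exact (he.aemeasurable_comp_iff.1 h1).aestronglyMeasurable

/-- Dyadic grids in each of the three coordinates feed the chaining bound. A parent node keeps the
discrete component, so only increments within one component are needed. The constant precedes the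
probability space and the field. -/
theorem exists_sup_bound {L T : ℝ} (hL : 0 < L) (hT : 0 < T) {δ p : ℝ} (hδ : 0 < δ) (hp : 1 ≤ p)
    (hpδ : 3 < p * δ) :
    ∃ C : ℝ≥0, ∀ (Ω : Type*) [MeasurableSpace Ω] (P : Measure Ω)
      (f : Ω → C(SpaceTime T L × Fin 3, ℝ)) (M : ℝ≥0∞),
      (∀ x, AEMeasurable (fun ω => f ω x) P) →
      (∀ x, eLpNorm' (fun ω => f ω x) p P ≤ M) →
      (∀ q r j, eLpNorm' (fun ω => f ω (q, j) - f ω (r, j)) p P ≤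
        M * ENNReal.ofReal (dist q r ^ δ)) →
      eLpNorm' f p P ≤ C * M := by
  have hp0 : 0 < p := by linarith
  let grid : ∀ (l : ℝ) (_ : 0 < l) (n : ℕ), Fin (2 ^ n) → Icc (0 : ℝ) l := fun l hl n i =>
    ⟨l * i / 2 ^ n, by positivity, by
      rw [div_le_iff₀ (by positivity)]
      gcongr
      exact_mod_cast i.2.le⟩
  let par : ∀ n : ℕ, Fin (2 ^ (n + 1)) → Fin (2 ^ n) := fun n i =>
    ⟨i / 2, by have h1 := i.2; have h2 := pow_succ 2 n; omega⟩
  have hpar : ∀ l hl n i, dist (grid l hl (n + 1) i) (grid l hl n (par n i)) ≤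
      l * (1 / 2 : ℝ) ^ (n + 1) := by
    rintro l hl n ⟨i, hin⟩
    have hi : (i : ℝ) = 2 * (i / 2 : ℕ) + (i % 2 : ℕ) := by
      exact_mod_cast (by omega : i = 2 * (i / 2) + i % 2)
    have hm : ((i % 2 : ℕ) : ℝ) ≤ 1 := by exact_mod_cast (by omega : i % 2 ≤ 1)
    rw [Subtype.dist_eq, Real.dist_eq]
    simp only [grid, par]
    rw [show l * (i : ℝ) / 2 ^ (n + 1) - l * ((i / 2 : ℕ) : ℝ) / 2 ^ n =
        l * ((i % 2 : ℕ) : ℝ) * (1 / 2) ^ (n + 1) by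
      rw [hi, one_div, inv_pow, pow_succ]
      field_simp
      ring, abs_of_nonneg (by positivity)]
    gcongr
    nlinarith
  have hdense : ∀ l hl (x : Icc (0 : ℝ) l), ∃ i : ∀ n, Fin (2 ^ n),
      Tendsto (fun n => grid l hl n (i n)) atTop (𝓝 x) := by
    intro l hl x
    have hb : ∀ n : ℕ, ∃ i : Fin (2 ^ n), dist (grid l hl n i) x ≤ l * (1 / 2 : ℝ) ^ n := by
      intro n
      have hx := x.2
      have hn : (0 : ℝ) < 2 ^ n := by positivity
      have key : ∀ i : ℕ, (hi : i < 2 ^ n) → (i : ℝ) ≤ x * 2 ^ n / l → (x * 2 ^ n / l : ℝ) ≤ i + 1 →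
          ∃ i : Fin (2 ^ n), dist (grid l hl n i) x ≤ l * (1 / 2 : ℝ) ^ n := by
        intro i hi h1 h2
        refine ⟨⟨i, hi⟩, ?_⟩
        rw [le_div_iff₀ hl] at h1
        rw [div_le_iff₀ hl] at h2
        rw [Subtype.dist_eq, Real.dist_eq, abs_sub_comm]
        simp only [grid]
        have e : (x : ℝ) - l * i / 2 ^ n = (x * 2 ^ n - l * i) * (1 / 2) ^ n := by
          rw [one_div, inv_pow]; field_simp
        rw [e, abs_mul, abs_of_nonneg (by linarith), abs_of_pos (by positivity)]
        gcongr
        linarith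
      by_cases hxl : (x : ℝ) < l
      · refine key ⌊(x : ℝ) * 2 ^ n / l⌋₊ ?_ (Nat.floor_le (by have := hx.1; positivity))
          (Nat.lt_floor_add_one _).le
        rw [Nat.floor_lt (by have := hx.1; positivity), div_lt_iff₀ hl]
        push_cast
        nlinarith
      -- The grids omit the right endpoint; it is approximated by the last node of each level.
      · have hxe : (x : ℝ) = l := le_antisymm hx.2 (not_lt.1 hxl)
        have h2n : 1 ≤ 2 ^ n := Nat.one_le_two_pow
        refine key (2 ^ n - 1) (by omega) ?_ ?_ <;>
        · rw [hxe, mul_div_assoc, mul_div_cancel₀ _ hl.ne', Nat.cast_sub h2n]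
          push_cast
          linarith
    choose i hi using hb
    refine ⟨i, ?_⟩
    rw [tendsto_iff_dist_tendsto_zero]
    refine squeeze_zero (fun _ => dist_nonneg) hi ?_
    simpa using (tendsto_pow_atTop_nhds_zero_of_lt_one (by norm_num : (0 : ℝ) ≤ 1 / 2)
      (by norm_num)).const_mul l
  let ι : ℕ → Type := fun n => (Fin (2 ^ n) × Fin (2 ^ n) × Fin (2 ^ n)) × Fin 3
  let g : ∀ n, ι n → SpaceTime T L × Fin 3 := fun n i =>
    ((grid T hT n i.1.1, grid L hL n i.1.2.1, grid L hL n i.1.2.2), i.2)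
  let π : ∀ n, ι (n + 1) → ι n := fun n i => ((par n i.1.1, par n i.1.2.1, par n i.1.2.2), i.2)
  have hgd : ∀ x, ∃ i : ∀ n, ι n, Tendsto (fun n => g n (i n)) atTop (𝓝 x) := by
    rintro ⟨⟨t, x, y⟩, j⟩
    obtain ⟨a, ha⟩ := hdense T hT t
    obtain ⟨b, hb⟩ := hdense L hL x
    obtain ⟨c, hc⟩ := hdense L hL y
    exact ⟨fun n => ((a n, b n, c n), j), (ha.prodMk_nhds (hb.prodMk_nhds hc)).prodMk_nhds
      tendsto_const_nhds⟩
  set D := max T L with hD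
  have hgπ : ∀ n i, dist (g (n + 1) i).1 (g n (π n i)).1 ≤ D * (1 / 2 : ℝ) ^ (n + 1) := by
    intro n i
    simp only [g, π, Prod.dist_eq]
    refine max_le ((hpar _ hT _ _).trans ?_) (max_le ((hpar _ hL _ _).trans ?_)
      ((hpar _ hL _ _).trans ?_)) <;> gcongr <;> simp [hD]
  -- Level n has 3·8^n nodes, while the links from level n to its parents are shorter than a
  -- multiple of 2^(-n). The chaining series is therefore geometric with this ratio, which is below
  -- 1 exactly when pδ > 3.
  set ρ : ℝ := (8 : ℝ) ^ (1 / p) * (1 / 2) ^ δ with hρ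
  have hρ0 : 0 < ρ := by positivity
  have hρ1 : ρ < 1 := by
    rw [hρ, show (8 : ℝ) = 2 ^ (3 : ℝ) by norm_num, ← Real.rpow_mul (by norm_num), one_div 2,
      Real.inv_rpow (by norm_num), ← Real.rpow_neg (by norm_num), ← Real.rpow_add (by norm_num)]
    refine Real.rpow_lt_one_of_one_lt_of_neg (by norm_num) ?_
    rw [mul_one_div, ← sub_eq_add_neg, sub_neg, div_lt_iff₀ hp0]
    linarith
  have hcard : ∀ n, (Fintype.card (ι n) : ℝ≥0∞) ^ (1 / p) =
      ENNReal.ofReal (3 ^ (1 / p) * ((8 : ℝ) ^ (1 / p)) ^ n) := by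
    intro n
    have hc : Fintype.card (ι n) = 3 * 8 ^ n := by
      simp only [ι, Fintype.card_prod, Fintype.card_fin]
      rw [show 8 = 2 * (2 * 2) by norm_num, mul_pow, mul_pow]
      ring
    rw [hc, ← Real.rpow_natCast, ← Real.rpow_mul (by norm_num), mul_comm (1 / p), Real.rpow_mul
      (by norm_num), ← Real.mul_rpow (by norm_num) (by positivity), Real.rpow_natCast,
      ← ENNReal.ofReal_rpow_of_nonneg (by positivity) (by positivity)]
    congr 1
    rw [ENNReal.ofReal_mul (by norm_num), ENNReal.ofReal_pow (by norm_num)]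
    simp
  refine ⟨(3 ^ (1 / p) + ∑' n : ℕ, 3 ^ (1 / p) * D ^ δ * ρ ^ (n + 1) : ℝ).toNNReal,
    fun Ω _ P f M hf h0 hinc => ?_⟩
  refine (eLpNorm'_le_chaining g π hgd hf hp (M := M)
    (A := fun n => M * ENNReal.ofReal ((D * (1 / 2 : ℝ) ^ (n + 1)) ^ δ)) (fun i => h0 _)
    fun n i => ?_).trans ?_
  · refine (hinc (g (n + 1) i).1 (g n (π n i)).1 i.2).trans ?_
    gcongr
    exact hgπ n i
  · have hs : Summable fun n : ℕ => 3 ^ (1 / p) * D ^ δ * ρ ^ (n + 1) :=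
      ((summable_geometric_of_lt_one hρ0.le hρ1).comp_injective
        (add_left_injective 1)).mul_left _
    have hD0 : 0 < D := lt_max_of_lt_left hT
    have hterm : ∀ n : ℕ, (Fintype.card (ι (n + 1)) : ℝ≥0∞) ^ (1 / p) *
        (M * ENNReal.ofReal ((D * (1 / 2 : ℝ) ^ (n + 1)) ^ δ)) =
        M * ENNReal.ofReal (3 ^ (1 / p) * D ^ δ * ρ ^ (n + 1)) := by
      intro n
      rw [hcard, mul_left_comm, ← ENNReal.ofReal_mul (by positivity),
        Real.mul_rpow hD0.le (by positivity), ← Real.rpow_natCast (1 / 2),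
        ← Real.rpow_mul (by norm_num), mul_comm _ δ, Real.rpow_mul (by norm_num),
        Real.rpow_natCast, hρ, mul_pow]
      congr 2
      ring
    rw [tsum_congr hterm, ENNReal.tsum_mul_left, hcard, ← ENNReal.ofReal_tsum_of_nonneg
      (fun n => by positivity) hs, mul_comm _ M, ← mul_add, mul_comm _ M,
      ← ENNReal.ofReal_add (by positivity) (tsum_nonneg fun n => by positivity)]
    simp [ENNReal.ofReal]

/-! ### Moments of Gaussian variables and their limits -/

/-- A centred Gaussian has the law of its standard deviation times a standard normal, so the ratio
of its norms is that of the standard normal. The degenerate case is covered by the same scaling. -/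
theorem exists_gaussian_moment_bound (p : ℝ≥0∞) (hp : p ≠ ∞) :
    ∃ c : ℝ≥0, ∀ (Ω : Type*) [MeasurableSpace Ω] (P : Measure Ω) (X : Ω → ℝ),
      HasGaussianLaw X P → ∫ ω, X ω ∂P = 0 → eLpNorm X p P ≤ c * eLpNorm X 2 P := by
  have hfin : ∀ q : ℝ≥0∞, q ≠ ∞ → eLpNorm id q (gaussianReal 0 1) ≠ ∞ := fun q hq =>
    (IsGaussian.memLp_id (gaussianReal 0 1) q hq).2.ne
  have h2 : eLpNorm id 2 (gaussianReal 0 1) ≠ 0 := by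
    intro h0
    have h1 := (eLpNorm_eq_zero_iff (by fun_prop) (by norm_num)).1 h0
    have h3 : Var[id; gaussianReal 0 1] = 0 := by
      rw [variance_congr h1]
      exact variance_zero _
    simp at h3
  refine ⟨(eLpNorm id p (gaussianReal 0 1) / eLpNorm id 2 (gaussianReal 0 1)).toNNReal,
    fun Ω _ P X hX h0 => ?_⟩
  rw [ENNReal.coe_toNNReal (ENNReal.div_ne_top (hfin p hp) h2)]
  have hlaw : P.map X = (gaussianReal 0 1).map (fun x => √Var[X; P] * x) := by
    rw [hX.map_eq_gaussianReal, h0, gaussianReal_map_const_mul]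
    congr 1
    · simp
    · ext
      simp [Real.sq_sqrt (variance_nonneg X P), variance_nonneg X P]
  have key : ∀ q : ℝ≥0∞, eLpNorm X q P =
      ‖√Var[X; P]‖ₑ * eLpNorm id q (gaussianReal 0 1) := by
    intro q
    have e1 : eLpNorm X q P = eLpNorm id q (P.map X) := by
      rw [eLpNorm_map_measure (by fun_prop) hX.aemeasurable]
      rfl
    rw [e1, hlaw, eLpNorm_map_measure (by fun_prop) (by fun_prop), ← eLpNorm_const_smul]
    rfl
  rw [key, key, mul_left_comm, ENNReal.div_mul_cancel h2 (hfin 2 (by norm_num))]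

/-- Moment comparisons pass to `L²` limits. -/
theorem eLpNorm_le_of_tendsto_L2 {Ω : Type*} [MeasurableSpace Ω] {P : Measure Ω}
    {X : ℕ → Ω → ℝ} {Y : Ω → ℝ}
    (hX : ∀ n, AEStronglyMeasurable (X n) P) (hY : AEStronglyMeasurable Y P)
    (hXY : Tendsto (fun n => eLpNorm (X n - Y) 2 P) atTop (𝓝 0)) {p : ℝ≥0∞} {c : ℝ≥0}
    (h : ∀ n, eLpNorm (X n) p P ≤ c * eLpNorm (X n) 2 P) :
    eLpNorm Y p P ≤ c * eLpNorm Y 2 P := by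
  -- Along an almost surely convergent subsequence, Fatou controls the L^p norm of the limit, while
  -- the L² norms are controlled by L² convergence.
  obtain ⟨φ, hφ, hae⟩ := (tendstoInMeasure_of_tendsto_eLpNorm (by norm_num) hX hY
    hXY).exists_seq_tendsto_ae
  have h1 : Tendsto (fun n => c * (eLpNorm (X (φ n) - Y) 2 P + eLpNorm Y 2 P)) atTop
      (𝓝 (c * (0 + eLpNorm Y 2 P))) :=
    ENNReal.Tendsto.const_mul ((hXY.comp hφ.tendsto_atTop).add tendsto_const_nhds)
      (Or.inr ENNReal.coe_ne_top)
  rw [zero_add] at h1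
  refine (Lp.eLpNorm_lim_le_liminf_eLpNorm (fun n => hX (φ n)) Y hae).trans ?_
  rw [← h1.liminf_eq]
  refine liminf_le_liminf (Eventually.of_forall fun n => (h (φ n)).trans ?_)
  gcongr
  have e : X (φ n) = (X (φ n) - Y) + Y := by simp
  conv_lhs => rw [e]
  exact eLpNorm_add_le ((hX _).sub hY) hY (by norm_num)

/-! ### The Wiener isometry -/

theorem tendsto_step (f : ℝ≥0 → ℝ) (hf : Continuous f) (t : ℝ≥0) (s : ℝ) :
    Tendsto (fun n : ℕ => ∑ i ∈ Finset.range n,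
      (Ioc ((t * i / n : ℝ≥0) : ℝ) ((t * (i + 1) / n : ℝ≥0) : ℝ)).indicator
          (fun _ => f (t * i / n)) s) atTop
      (𝓝 ((Ioc (0 : ℝ) t).indicator (fun r => f r.toNNReal) s)) := by
  by_cases hs : s ∈ Ioc (0 : ℝ) t
  · rw [indicator_of_mem hs]
    -- The partition is degenerate at n = 0, so the sampling point is constrained only for positive
    -- n.
    have h : ∀ n : ℕ, ∃ r : ℝ≥0, 0 < n → (|(r : ℝ) - s| ≤ t / n ∧ ∑ i ∈ Finset.range n,
        (Ioc ((t * i / n : ℝ≥0) : ℝ) ((t * (i + 1) / n : ℝ≥0) : ℝ)).indicator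
          (fun _ => f (t * i / n)) s = f r) := by
      intro n
      by_cases hn : 0 < n
      · obtain ⟨r, -, h1, h2⟩ := step_apply f t n s hs hn
        exact ⟨r, fun _ => ⟨h1, h2⟩⟩
      · exact ⟨0, fun h => absurd h hn⟩
    choose r hr using h
    have hr' : Tendsto r atTop (𝓝 s.toNNReal) := by
      rw [← NNReal.tendsto_coe, Real.coe_toNNReal _ hs.1.le, tendsto_iff_dist_tendsto_zero]
      refine squeeze_zero' (Eventually.of_forall fun _ => dist_nonneg) ?_
        (tendsto_const_div_atTop_nhds_zero_nat (t : ℝ))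
      filter_upwards [eventually_gt_atTop 0] with n hn
      exact (hr n hn).1
    refine ((hf.tendsto _).comp hr').congr' ?_
    filter_upwards [eventually_gt_atTop 0] with n hn
    exact (hr n hn).2.symm
  · rw [indicator_of_notMem hs]
    exact tendsto_const_nhds.congr fun n => (step_apply_zero f t n s hs).symm

theorem exists_step_bound (f : ℝ≥0 → ℝ) (hf : Continuous f) (t : ℝ≥0) :
    ∃ M : ℝ, 0 ≤ M ∧ ∀ (n : ℕ) (s : ℝ), |∑ i ∈ Finset.range n,
      (Ioc ((t * i / n : ℝ≥0) : ℝ) ((t * (i + 1) / n : ℝ≥0) : ℝ)).indicator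
          (fun _ => f (t * i / n)) s| ≤ (Ioc (0 : ℝ) t).indicator (fun _ => M) s := by
  obtain ⟨M, hM⟩ := (isCompact_Icc (a := (0 : ℝ≥0)) (b := t)).exists_bound_of_continuousOn
    hf.continuousOn
  have hM0 : 0 ≤ M := (norm_nonneg _).trans (hM 0 ⟨le_rfl, zero_le⟩)
  refine ⟨M, hM0, fun n s => ?_⟩
  by_cases hs : s ∈ Ioc (0 : ℝ) t
  · rw [indicator_of_mem hs]
    rcases Nat.eq_zero_or_pos n with rfl | hn
    · simpa using hM0
    · obtain ⟨r, hr, -, h2⟩ := step_apply f t n s hs hn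
      rw [h2]
      exact hM r ⟨zero_le, hr⟩
  · rw [step_apply_zero f t n s hs, indicator_of_notMem hs, abs_zero]

/-- The step functions approximating `f` on `(0,t]`, in `L²(ℝ)`. -/
def stepL2 (f : ℝ≥0 → ℝ) (t : ℝ≥0) (n : ℕ) : Lp ℝ 2 (volume : Measure ℝ) :=
  ∑ i ∈ Finset.range n, f (t * i / n) • (indL2 (t * (i + 1) / n) - indL2 (t * i / n))

/-- The partitions of [0,t] and [0,s] do not match, so the inner product is not a Riemann sum.
Dominated convergence of the product of step functions avoids this; the limiting supports meet in
(0, min t s]. -/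
theorem tendsto_inner_stepL2 {f g : ℝ≥0 → ℝ} (hf : Continuous f) (hg : Continuous g) (t s : ℝ≥0) :
    Tendsto (fun n => inner ℝ (stepL2 f t n) (stepL2 g s n)) atTop
      (𝓝 (∫ r in Ioc (0 : ℝ) (min t s : ℝ≥0), f r.toNNReal * g r.toNNReal)) := by
  obtain ⟨M, hM0, hM⟩ := exists_step_bound f hf t
  obtain ⟨N, hN0, hN⟩ := exists_step_bound g hg s
  have e : (∫ r in Ioc (0 : ℝ) (min t s : ℝ≥0), f r.toNNReal * g r.toNNReal) =
      ∫ r, (Ioc (0 : ℝ) t).indicator (fun r => f r.toNNReal) r *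
        (Ioc (0 : ℝ) s).indicator (fun r => g r.toNNReal) r := by
    rw [← integral_indicator measurableSet_Ioc]
    congr 1 with r
    rw [← inter_indicator_mul, Ioc_inter_Ioc, max_self, NNReal.coe_min]
  rw [e]
  have e2 : ∀ n, inner ℝ (stepL2 f t n) (stepL2 g s n) = ∫ r : ℝ, (∑ i ∈ Finset.range n,
      (Ioc ((t * i / n : ℝ≥0) : ℝ) ((t * (i + 1) / n : ℝ≥0) : ℝ)).indicator
          (fun _ => f (t * i / n)) r) * (∑ i ∈ Finset.range n,
      (Ioc ((s * i / n : ℝ≥0) : ℝ) ((s * (i + 1) / n : ℝ≥0) : ℝ)).indicator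
          (fun _ => g (s * i / n)) r) := by
    intro n
    rw [L2.inner_def]
    refine integral_congr_ae ?_
    filter_upwards [coeFn_step f t n, coeFn_step g s n] with r h1 h2
    rw [stepL2, stepL2, h1, h2]
    simp [mul_comm]
  simp_rw [e2]
  refine tendsto_integral_of_dominated_convergence
    (fun r => (Ioc (0 : ℝ) t).indicator (fun _ => M * N) r) (fun n => ?_) ?_ (fun n => ?_) ?_
  · refine Measurable.aestronglyMeasurable ?_
    refine Measurable.mul ?_ ?_ <;>
    exact Finset.measurable_fun_sum _ fun i _ => measurable_const.indicator measurableSet_Ioc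
  · rw [integrable_indicator_iff measurableSet_Ioc]
    exact integrableOn_const measure_Ioc_lt_top.ne
  · refine Eventually.of_forall fun r => ?_
    rw [Real.norm_eq_abs, abs_mul]
    have h1 := hM n r
    have h2 := (hN n r).trans (indicator_le_self' (fun _ _ => hN0) r)
    by_cases hr : r ∈ Ioc (0 : ℝ) t
    · rw [indicator_of_mem hr] at h1 ⊢
      gcongr
    · rw [indicator_of_notMem hr] at h1 ⊢
      rw [le_antisymm h1 (abs_nonneg _), zero_mul]
  · exact Eventually.of_forall fun r => (tendsto_step f hf t r).mul (tendsto_step g hg s r)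

theorem memLp_brownian {Ω : Type*} [MeasurableSpace Ω] {P : Measure Ω}
    {B : ℝ≥0 → Ω → ℝ} (hB : IsBrownianReal B P) (s : ℝ≥0) : MemLp (B s) 2 P :=
  (hB.isGaussianProcess.hasGaussianLaw_eval s).memLp_two

theorem memLp_wienerSum {Ω : Type*} [MeasurableSpace Ω] {P : Measure Ω}
    {B : ℝ≥0 → Ω → ℝ} (hB : IsBrownianReal B P) (f : ℝ≥0 → ℝ) (t : ℝ≥0) (n : ℕ) :
    MemLp (wienerSum B f t n) 2 P := by
  unfold wienerSum
  exact memLp_finsetSum _ fun i _ => ((memLp_brownian hB _).sub (memLp_brownian hB _)).const_mul _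

theorem integral_brownian_mul {Ω ι : Type*} [MeasurableSpace Ω] {P : Measure Ω}
    {β : ι → ℝ≥0 → Ω → ℝ} (hβ : ∀ k, IsBrownianReal (β k) P)
    (hind : iIndepFun (fun k ω t => β k t ω) P) [DecidableEq ι] (k l : ι) (s u : ℝ≥0) :
    ∫ ω, β k s ω * β l u ω ∂P = if k = l then ((min s u : ℝ≥0) : ℝ) else 0 := by
  have := hind.isProbabilityMeasure
  have h1 : ∫ ω, β k s ω * β l u ω ∂P = cov[β k s, β l u; P] := by
    rw [covariance_eq_sub (memLp_brownian (hβ k) s) (memLp_brownian (hβ l) u),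
      (hβ k).integral_eval, zero_mul, sub_zero]
    rfl
  rw [h1]
  split_ifs with h
  · subst h
    exact (hβ k).covariance_eval s u
  · have h2 : IndepFun (β k s) (β l u) P :=
      (hind.indepFun h).comp (measurable_pi_apply s) (measurable_pi_apply u)
    exact h2.covariance_eq_zero (memLp_brownian (hβ k) s) (memLp_brownian (hβ l) u)

/-- Brownian covariances are inner products of the indicators `indL2`, so bilinearity identifies
Riemann sums with step functions. Independence removes the mixed terms. -/
theorem integral_wienerSum_mul {Ω ι : Type*} [MeasurableSpace Ω] {P : Measure Ω}
    {β : ι → ℝ≥0 → Ω → ℝ} (hβ : ∀ k, IsBrownianReal (β k) P)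
    (hind : iIndepFun (fun k ω t => β k t ω) P) [DecidableEq ι] (k l : ι) (f g : ℝ≥0 → ℝ)
    (t s : ℝ≥0) (n : ℕ) :
    ∫ ω, wienerSum (β k) f t n ω * wienerSum (β l) g s n ω ∂P =
      if k = l then inner ℝ (stepL2 f t n) (stepL2 g s n) else 0 := by
  have hi : ∀ k l s u, Integrable (fun ω => β k s ω * β l u ω) P := fun k l s u =>
    (memLp_brownian (hβ k) s).integrable_mul (memLp_brownian (hβ l) u)
  have hprod : ∀ a b c d, ∫ ω, (β k a ω - β k b ω) * (β l c ω - β l d ω) ∂P =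
      if k = l then inner ℝ (indL2 a - indL2 b) (indL2 c - indL2 d) else 0 := by
    intro a b c d
    have e : ∀ ω, (β k a ω - β k b ω) * (β l c ω - β l d ω) = (β k a ω * β l c ω -
      β k a ω * β l d ω) - (β k b ω * β l c ω - β k b ω * β l d ω) := fun ω => by ring
    have hi2 : ∀ a, Integrable (fun ω => β k a ω * β l c ω - β k a ω * β l d ω) P :=
      fun a => (hi _ _ _ _).sub (hi _ _ _ _)
    simp_rw [e]
    rw [integral_sub (hi2 _) (hi2 _),
      integral_sub (hi _ _ _ _) (hi _ _ _ _), integral_sub (hi _ _ _ _) (hi _ _ _ _)]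
    simp only [integral_brownian_mul hβ hind, inner_sub_left, inner_sub_right, inner_indL2]
    split_ifs <;> ring
  have hii : ∀ a b c d, Integrable (fun ω => (β k a ω - β k b ω) * (β l c ω - β l d ω)) P :=
    fun a b c d => ((memLp_brownian (hβ k) a).sub (memLp_brownian (hβ k) b)).integrable_mul
      ((memLp_brownian (hβ l) c).sub (memLp_brownian (hβ l) d))
  simp only [wienerSum, Finset.sum_mul_sum]
  have e : ∀ (ω : Ω) (i j : ℕ), f (t * i / n) * (β k (t * (i + 1) / n) ω - β k (t * i / n) ω) *
      (g (s * j / n) * (β l (s * (j + 1) / n) ω - β l (s * j / n) ω)) =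
      (f (t * i / n) * g (s * j / n)) * ((β k (t * (i + 1) / n) ω - β k (t * i / n) ω) *
      (β l (s * (j + 1) / n) ω - β l (s * j / n) ω)) := fun ω i j => by ring
  simp_rw [e]
  rw [integral_finsetSum _ fun i _ => integrable_finsetSum _ fun j _ => (hii _ _ _ _).const_mul _]
  simp_rw [integral_finsetSum _ fun j _ => (hii _ _ _ _).const_mul _, integral_const_mul, hprod,
    stepL2, sum_inner, inner_sum, inner_smul_left, inner_smul_right]
  split_ifs
  · simp [mul_assoc]
  · simp

theorem HasWienerIntegral.tendsto_toLp {Ω : Type*} [MeasurableSpace Ω] {P : Measure Ω}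
    {B : ℝ≥0 → Ω → ℝ} (hB : IsBrownianReal B P) {f : ℝ≥0 → ℝ} {t : ℝ≥0} {I : Ω → ℝ}
    (hI : HasWienerIntegral P B f t I) :
    Tendsto (fun n => (memLp_wienerSum hB f t n).toLp) atTop (𝓝 hI.1.toLp) := by
  rw [Lp.tendsto_Lp_iff_tendsto_eLpNorm'']
  exact hI.2

/-- The Wiener isometry. -/
theorem integral_wiener_mul {Ω ι : Type*} [MeasurableSpace Ω] {P : Measure Ω}
    {β : ι → ℝ≥0 → Ω → ℝ} (hβ : ∀ k, IsBrownianReal (β k) P)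
    (hind : iIndepFun (fun k ω t => β k t ω) P) [DecidableEq ι] {k l : ι} {f g : ℝ≥0 → ℝ}
    (hf : Continuous f) (hg : Continuous g) {t s : ℝ≥0} {I J : Ω → ℝ}
    (hI : HasWienerIntegral P (β k) f t I) (hJ : HasWienerIntegral P (β l) g s J) :
    ∫ ω, I ω * J ω ∂P = if k = l then
      ∫ r in Ioc (0 : ℝ) (min t s : ℝ≥0), f r.toNNReal * g r.toNNReal else 0 := by
  have hin : ∀ {X Y : Ω → ℝ} (hX : MemLp X 2 P) (hY : MemLp Y 2 P),
      inner ℝ hX.toLp hY.toLp = ∫ ω, X ω * Y ω ∂P := by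
    intro X Y hX hY
    rw [L2.inner_def]
    refine integral_congr_ae ?_
    filter_upwards [hX.coeFn_toLp, hY.coeFn_toLp] with ω h1 h2
    rw [h1, h2]
    simp [mul_comm]
  have h1 := (hI.tendsto_toLp (hβ k)).inner (𝕜 := ℝ) (hJ.tendsto_toLp (hβ l))
  simp_rw [hin, integral_wienerSum_mul hβ hind] at h1
  refine tendsto_nhds_unique h1 ?_
  split_ifs
  · exact tendsto_inner_stepL2 hf hg t s
  · exact tendsto_const_nhds

/-! ### Moments of the modes of the stochastic convolution -/

theorem one_le_freqNorm (k : Freq) : 1 ≤ freqNorm k := by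
  rw [freqNorm, Real.one_le_sqrt]
  have h : (1 : ℤ) ≤ k.1.1 ^ 2 + k.1.2 ^ 2 := by
    by_contra! hcon
    have h1 : k.1.1 = 0 := by nlinarith [sq_nonneg k.1.1, sq_nonneg k.1.2]
    have h2 : k.1.2 = 0 := by nlinarith [sq_nonneg k.1.1, sq_nonneg k.1.2]
    exact k.2 (Prod.ext h1 h2)
  exact_mod_cast h

theorem eigenvalue_pos {L : ℝ} (hL : 0 < L) (k : Freq) : 0 < eigenvalue L k := by
  have := one_le_freqNorm k
  unfold eigenvalue
  positivity

/-- The integrand is exp(-c(t+s)) exp(2cr), and 2 min(t,s) - t - s = -|t-s|. -/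
theorem integral_exp_mul_exp {c : ℝ} (hc : 0 < c) (t s : ℝ≥0) :
    ∫ r in Ioc (0 : ℝ) (min t s : ℝ≥0),
      Real.exp (-((t : ℝ) - r.toNNReal) * c) * Real.exp (-((s : ℝ) - r.toNNReal) * c) =
    (Real.exp (-(c * |(t : ℝ) - s|)) - Real.exp (-(c * (t + s)))) / (2 * c) := by
  have h1 : ∫ r in Ioc (0 : ℝ) (min t s : ℝ≥0),
      Real.exp (-((t : ℝ) - r.toNNReal) * c) * Real.exp (-((s : ℝ) - r.toNNReal) * c) =
      ∫ r in (0 : ℝ)..(min t s : ℝ≥0), Real.exp (-(c * (t + s))) * Real.exp (2 * c * r) := by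
    rw [intervalIntegral.integral_of_le (NNReal.coe_nonneg _)]
    refine setIntegral_congr_fun measurableSet_Ioc fun r hr => ?_
    rw [Real.coe_toNNReal _ hr.1.le, ← Real.exp_add, ← Real.exp_add]
    congr 1
    ring
  rw [h1, intervalIntegral.integral_const_mul,
    intervalIntegral.integral_comp_mul_left (fun x => Real.exp x) (by positivity), integral_exp]
  simp only [mul_zero, Real.exp_zero, smul_eq_mul]
  have h2 : Real.exp (-(c * (t + s))) * Real.exp (2 * c * (min t s : ℝ≥0)) =
      Real.exp (-(c * |(t : ℝ) - s|)) := by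
    rw [← Real.exp_add]
    congr 1
    rw [NNReal.coe_min]
    rcases le_total (t : ℝ) s with h | h
    · rw [min_eq_left h, abs_of_nonpos (by linarith)]; ring
    · rw [min_eq_right h, abs_of_nonneg (by linarith)]; ring
  rw [← h2]
  field_simp

section Modes

variable {Ω : Type*} [MeasurableSpace Ω] {P : Measure Ω} {β : Freq → ℝ≥0 → Ω → ℝ}

theorem hasWienerIntegral_modeConvolution (hβ : ∀ k, IsBrownianReal (β k) P) (L : ℝ) (k : Freq)
    (t : ℝ≥0) : HasWienerIntegral P (β k)
      (fun s => Real.exp (-((t : ℝ) - s) * eigenvalue L k ^ 2)) t (modeConvolution P β L k t) := by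
  have hB := hβ k
  have := hB.isGaussianProcess.isProbabilityMeasure
  exact hasWienerIntegral_wienerIntegral (hβ k) (by fun_prop) t

theorem memLp_modeConvolution (hβ : ∀ k, IsBrownianReal (β k) P) (L : ℝ) (k : Freq)
    (t : ℝ≥0) : MemLp (modeConvolution P β L k t) 2 P :=
  (hasWienerIntegral_modeConvolution hβ L k t).1

open Classical in
theorem integral_modeConvolution_mul (hβ : ∀ k, IsBrownianReal (β k) P)
    (hind : iIndepFun (fun k ω t => β k t ω) P) {L : ℝ} (hL : 0 < L) (k l : Freq) (t s : ℝ≥0) :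
    ∫ ω, modeConvolution P β L k t ω * modeConvolution P β L l s ω ∂P = if k = l then
      (Real.exp (-(eigenvalue L k ^ 2 * |(t : ℝ) - s|)) -
        Real.exp (-(eigenvalue L k ^ 2 * (t + s)))) / (2 * eigenvalue L k ^ 2) else 0 := by
  rw [integral_wiener_mul hβ hind (by fun_prop) (by fun_prop)
    (hasWienerIntegral_modeConvolution hβ L k t) (hasWienerIntegral_modeConvolution hβ L l s)]
  split_ifs with h
  · subst h
    exact integral_exp_mul_exp (pow_pos (eigenvalue_pos hL k) 2) t s
  · rfl

/-- The weights stand for values of a basis function at two points, so displacements in time and in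
space are estimated together. Taking b = 0 gives a bound on the variance itself. -/
theorem integral_modeConvolution_sub_sq_le (hβ : ∀ k, IsBrownianReal (β k) P)
    (hind : iIndepFun (fun k ω t => β k t ω) P) {L : ℝ} (hL : 0 < L) (k : Freq) (t s : ℝ≥0)
    (a b : ℝ) :
    ∫ ω, (a * modeConvolution P β L k t ω - b * modeConvolution P β L k s ω) ^ 2 ∂P ≤
      ((a - b) ^ 2 + 2 * b ^ 2 * (1 - Real.exp (-(eigenvalue L k ^ 2 * |(t : ℝ) - s|)))) /
        eigenvalue L k ^ 2 := by
  have hi : ∀ t s, Integrable (fun ω => modeConvolution P β L k t ω *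
      modeConvolution P β L k s ω) P := fun t s =>
    (memLp_modeConvolution hβ L k t).integrable_mul (memLp_modeConvolution hβ L k s)
  have e : ∀ ω, (a * modeConvolution P β L k t ω - b * modeConvolution P β L k s ω) ^ 2 =
      (a ^ 2 * (modeConvolution P β L k t ω * modeConvolution P β L k t ω) +
      b ^ 2 * (modeConvolution P β L k s ω * modeConvolution P β L k s ω)) -
      (2 * a * b) * (modeConvolution P β L k t ω * modeConvolution P β L k s ω) :=
    fun ω => by ring
  have hi2 : Integrable (fun ω =>
      a ^ 2 * (modeConvolution P β L k t ω * modeConvolution P β L k t ω) +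
      b ^ 2 * (modeConvolution P β L k s ω * modeConvolution P β L k s ω)) P :=
    ((hi t t).const_mul _).add ((hi s s).const_mul _)
  simp_rw [e]
  rw [integral_sub hi2 ((hi t s).const_mul _),
    integral_add ((hi t t).const_mul _) ((hi s s).const_mul _)]
  simp_rw [integral_const_mul, integral_modeConvolution_mul hβ hind hL, if_true]
  have hc : 0 < eigenvalue L k ^ 2 := pow_pos (eigenvalue_pos hL k) 2
  set c := eigenvalue L k ^ 2
  simp only [sub_self, abs_zero, mul_zero, neg_zero, Real.exp_zero]
  have e1 : Real.exp (-(c * ((t : ℝ) + t))) = Real.exp (-(c * t)) ^ 2 := by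
    rw [sq, ← Real.exp_add]; congr 1; ring
  have e2 : Real.exp (-(c * ((s : ℝ) + s))) = Real.exp (-(c * s)) ^ 2 := by
    rw [sq, ← Real.exp_add]; congr 1; ring
  have e3 : Real.exp (-(c * ((t : ℝ) + s))) = Real.exp (-(c * t)) * Real.exp (-(c * s)) := by
    rw [← Real.exp_add]; congr 1; ring
  rw [e1, e2, e3]
  set x := Real.exp (-(c * t))
  set y := Real.exp (-(c * s))
  have hz1 : Real.exp (-(c * |(t : ℝ) - s|)) ≤ 1 := Real.exp_le_one_iff.2 (by
    have := abs_nonneg ((t : ℝ) - s); nlinarith)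
  have hz0 := Real.exp_pos (-(c * |(t : ℝ) - s|))
  set z := Real.exp (-(c * |(t : ℝ) - s|))
  rw [← mul_div_assoc, ← mul_div_assoc, ← mul_div_assoc, ← add_div, ← sub_div,
    div_le_div_iff₀ (by positivity) hc]
  -- The left side equals a² + b² - 2abz - (ax - by)². Drop the last square, write 2ab = 2b² +
  -- 2b(a-b), and use 2b(a-b) ≤ (a-b)² + b².
  have : a ^ 2 * (1 - x ^ 2) + b ^ 2 * (1 - y ^ 2) - 2 * a * b * (z - x * y) ≤
      2 * ((a - b) ^ 2 + 2 * b ^ 2 * (1 - z)) := by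
    nlinarith [sq_nonneg (a * x - b * y), mul_nonneg (sq_nonneg (a - b - b)) (sub_nonneg.2 hz1),
      mul_nonneg (sq_nonneg (a - b)) hz0.le, mul_nonneg (sq_nonneg b) (sub_nonneg.2 hz1)]
  nlinarith

/-- Pythagoras: distinct modes are orthogonal at all pairs of times. -/
theorem integral_sum_modeConvolution_sub_sq (hβ : ∀ k, IsBrownianReal (β k) P)
    (hind : iIndepFun (fun k ω t => β k t ω) P) {L : ℝ} (hL : 0 < L) (F : Finset Freq)
    (t s : ℝ≥0) (a b : Freq → ℝ) :
    ∫ ω, (∑ k ∈ F, (a k * modeConvolution P β L k t ω - b k * modeConvolution P β L k s ω)) ^ 2 ∂P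
      = ∑ k ∈ F,
        ∫ ω, (a k * modeConvolution P β L k t ω - b k * modeConvolution P β L k s ω) ^ 2 ∂P := by
  set D : Freq → Ω → ℝ := fun k ω =>
    a k * modeConvolution P β L k t ω - b k * modeConvolution P β L k s ω with hD
  have hm : ∀ k, MemLp (D k) 2 P := fun k =>
    ((memLp_modeConvolution hβ L k t).const_mul _).sub
      ((memLp_modeConvolution hβ L k s).const_mul _)
  have hi : ∀ k l, Integrable (fun ω => D k ω * D l ω) P := fun k l =>
    (hm k).integrable_mul (hm l)
  have horth : ∀ k l, k ≠ l → ∫ ω, D k ω * D l ω ∂P = 0 := by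
    intro k l hkl
    have hi : ∀ t s, Integrable (fun ω => modeConvolution P β L k t ω *
        modeConvolution P β L l s ω) P := fun t s =>
      (memLp_modeConvolution hβ L k t).integrable_mul (memLp_modeConvolution hβ L l s)
    have e : ∀ ω, D k ω * D l ω =
      ((a k * a l) * (modeConvolution P β L k t ω * modeConvolution P β L l t ω) +
      (b k * b l) * (modeConvolution P β L k s ω * modeConvolution P β L l s ω)) -
      ((a k * b l) * (modeConvolution P β L k t ω * modeConvolution P β L l s ω) +
      (b k * a l) * (modeConvolution P β L k s ω * modeConvolution P β L l t ω)) :=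
      fun ω => by simp only [hD]; ring
    simp_rw [e]
    rw [integral_sub (by exact ((hi _ _).const_mul _).add ((hi _ _).const_mul _))
      (by exact ((hi _ _).const_mul _).add ((hi _ _).const_mul _)),
      integral_add ((hi _ _).const_mul _) ((hi _ _).const_mul _),
      integral_add ((hi _ _).const_mul _) ((hi _ _).const_mul _)]
    simp_rw [integral_const_mul, integral_modeConvolution_mul hβ hind hL, if_neg hkl]
    simp
  simp_rw [sq, Finset.sum_mul_sum]
  rw [integral_finsetSum _ fun i _ => integrable_finsetSum _ fun j _ => hi i j]
  refine Finset.sum_congr rfl fun k hk => ?_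
  rw [integral_finsetSum _ fun j _ => hi k j]
  exact Finset.sum_eq_single_of_mem k hk fun l _ hl => horth k l hl.symm

end Modes

/-! ### Gaussian moment comparison for the modes -/

theorem hasGaussianLaw_of_mem_span {Ω : Type*} [MeasurableSpace Ω] {P : Measure Ω}
    {B : ℝ≥0 → Ω → ℝ} (hB : IsBrownianReal B P) {Y : Ω → ℝ}
    (hY : Y ∈ Submodule.span ℝ (range B)) : HasGaussianLaw Y P := by
  have hX := hB.isGaussianProcess
  obtain ⟨c, rfl⟩ := Finsupp.mem_span_range_iff_exists_finsupp.1 hY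
  exact (hX.smul c).hasGaussianLaw_sum (I := c.support)

theorem integral_wienerSum {Ω : Type*} [MeasurableSpace Ω] {P : Measure Ω}
    {B : ℝ≥0 → Ω → ℝ} (hB : IsBrownianReal B P) (f : ℝ≥0 → ℝ) (t : ℝ≥0) (n : ℕ) :
    ∫ ω, wienerSum B f t n ω ∂P = 0 := by
  unfold wienerSum
  rw [integral_finsetSum _ fun i _ => by
    exact ((hB.integrable_eval _).sub (hB.integrable_eval _)).const_mul _]
  refine Finset.sum_eq_zero fun i _ => ?_
  rw [integral_const_mul, integral_sub (hB.integrable_eval _) (hB.integrable_eval _),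
    hB.integral_eval, hB.integral_eval, sub_zero, mul_zero]

theorem wienerSum_mem_span {Ω : Type*} (B : ℝ≥0 → Ω → ℝ) (f : ℝ≥0 → ℝ) (t : ℝ≥0) (n : ℕ) :
    wienerSum B f t n ∈ Submodule.span ℝ (range B) := by
  have e : wienerSum B f t n = ∑ i ∈ Finset.range n,
      f (t * i / n) • (B (t * (i + 1) / n) - B (t * i / n)) := by
    ext ω
    simp [wienerSum, Finset.sum_apply]
  rw [e]
  exact Submodule.sum_mem _ fun i _ => Submodule.smul_mem _ _
    (Submodule.sub_mem _ (Submodule.subset_span (mem_range_self _))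
      (Submodule.subset_span (mem_range_self _)))

theorem measurable_wienerSum_eval (f : ℝ≥0 → ℝ) (t : ℝ≥0) (n : ℕ) :
    Measurable (wienerSum (fun s (b : ℝ≥0 → ℝ) => b s) f t n) := by
  unfold wienerSum
  fun_prop

/-- Each summand is a linear combination of values of one Brownian motion, hence Gaussian; the
summands are independent, so their sum is Gaussian. -/
theorem hasGaussianLaw_sum_wienerSum {Ω ι : Type*} [MeasurableSpace Ω] {P : Measure Ω}
    {β : ι → ℝ≥0 → Ω → ℝ} (hβ : ∀ k, IsBrownianReal (β k) P)
    (hind : iIndepFun (fun k ω t => β k t ω) P) (F : Finset ι) (t s : ℝ≥0)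
    (f g : ι → ℝ≥0 → ℝ) (a b : ι → ℝ) (n : ℕ) :
    HasGaussianLaw (fun ω => ∑ k ∈ F, (a k * wienerSum (β k) (f k) t n ω -
      b k * wienerSum (β k) (g k) s n ω)) P := by
  have h1 : iIndepFun (fun (k : F) ω => a k * wienerSum (β k) (f k) t n ω -
      b k * wienerSum (β k) (g k) s n ω) P :=
    (hind.precomp (g := ((↑) : F → ι)) Subtype.val_injective).comp
      (fun k b' => a k * wienerSum (fun s b => b s) (f k) t n b' -
        b k * wienerSum (fun s b => b s) (g k) s n b')
      (fun k => ((measurable_wienerSum_eval _ _ _).const_mul _).sub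
        ((measurable_wienerSum_eval _ _ _).const_mul _))
  have h2 := iIndepFun.hasGaussianLaw_fun_sum (fun k : F => hasGaussianLaw_of_mem_span (hβ k)
    (Submodule.sub_mem _
      (Submodule.smul_mem _ (a k) (wienerSum_mem_span (β k) (f k) t n))
      (Submodule.smul_mem _ (b k) (wienerSum_mem_span (β k) (g k) s n)))) h1
  refine h2.congr (Eventually.of_forall fun ω => ?_)
  exact (Finset.sum_coe_sort F (fun k => a k * wienerSum (β k) (f k) t n ω -
      b k * wienerSum (β k) (g k) s n ω))

/-- Only the Riemann sums are shown to be Gaussian. Their norm comparison survives the L² limit, so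
the law of the Wiener integrals is never needed. The constant depends on p alone. -/
theorem exists_mode_moment_bound (p : ℝ≥0∞) (hp : p ≠ ∞) :
    ∃ c : ℝ≥0, ∀ (Ω : Type*) [MeasurableSpace Ω] (P : Measure Ω) (β : Freq → ℝ≥0 → Ω → ℝ),
      (∀ k, IsBrownianReal (β k) P) → iIndepFun (fun k ω t => β k t ω) P →
      ∀ (L : ℝ) (F : Finset Freq) (t s : ℝ≥0) (a b : Freq → ℝ),
        eLpNorm (fun ω => ∑ k ∈ F, (a k * modeConvolution P β L k t ω -
          b k * modeConvolution P β L k s ω)) p P ≤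
        c * eLpNorm (fun ω => ∑ k ∈ F, (a k * modeConvolution P β L k t ω -
          b k * modeConvolution P β L k s ω)) 2 P := by
  obtain ⟨c, hc⟩ := exists_gaussian_moment_bound p hp
  refine ⟨c, fun Ω _ P β hβ hind L F t s a b => ?_⟩
  let f : ℝ≥0 → Freq → ℝ≥0 → ℝ := fun t k s => Real.exp (-((t : ℝ) - s) * eigenvalue L k ^ 2)
  let W : ℝ≥0 → Freq → ℕ → Ω → ℝ := fun t k n => wienerSum (β k) (f t k) t n
  have hW : ∀ t k n, MemLp (W t k n) 2 P := fun t k n => memLp_wienerSum (hβ k) _ _ _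
  have hM : ∀ t k, MemLp (modeConvolution P β L k t) 2 P := fun t k =>
    memLp_modeConvolution hβ L k t
  have hWM : ∀ t k, Tendsto (fun n => eLpNorm (fun ω => W t k n ω - modeConvolution P β L k t ω) 2 P)
      atTop (𝓝 0) := fun t k => (hasWienerIntegral_modeConvolution hβ L k t).2
  refine eLpNorm_le_of_tendsto_L2
    (X := fun n ω => ∑ k ∈ F, (a k * W t k n ω - b k * W s k n ω)) (fun n => ?_) ?_ ?_ fun n => ?_
  · exact (memLp_finsetSum _ fun k _ =>
      ((hW t k n).const_mul _).sub ((hW s k n).const_mul _)).aestronglyMeasurable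
  · exact (memLp_finsetSum _ fun k _ =>
      ((hM t k).const_mul _).sub ((hM s k).const_mul _)).aestronglyMeasurable
  · have hlim : Tendsto (fun n => ∑ k ∈ F,
        (‖a k‖ₑ * eLpNorm (fun ω => W t k n ω - modeConvolution P β L k t ω) 2 P +
        ‖b k‖ₑ * eLpNorm (fun ω => W s k n ω - modeConvolution P β L k s ω) 2 P)) atTop (𝓝 0) := by
      have : (0 : ℝ≥0∞) = ∑ k ∈ F, (‖a k‖ₑ * 0 + ‖b k‖ₑ * 0) := by simp
      rw [this]
      exact tendsto_finsetSum _ fun k _ =>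
        (ENNReal.Tendsto.const_mul (hWM t k) (Or.inr enorm_ne_top)).add
          (ENNReal.Tendsto.const_mul (hWM s k) (Or.inr enorm_ne_top))
    refine tendsto_of_tendsto_of_tendsto_of_le_of_le tendsto_const_nhds hlim
      (fun _ => zero_le) fun n => ?_
    have hd : ∀ t k, AEStronglyMeasurable (fun ω => W t k n ω - modeConvolution P β L k t ω) P :=
      fun t k => ((hW t k n).sub (hM t k)).aestronglyMeasurable
    have e : ((fun ω => ∑ k ∈ F, (a k * W t k n ω - b k * W s k n ω)) -
        fun ω => ∑ k ∈ F, (a k * modeConvolution P β L k t ω - b k * modeConvolution P β L k s ω)) =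
        ∑ k ∈ F, ((a k • fun ω => W t k n ω - modeConvolution P β L k t ω) -
          b k • fun ω => W s k n ω - modeConvolution P β L k s ω) := by
      ext ω
      simp only [Pi.sub_apply, Finset.sum_apply, Pi.smul_apply, smul_eq_mul,
        ← Finset.sum_sub_distrib]
      exact Finset.sum_congr rfl fun k _ => by ring
    simp only
    rw [e]
    refine (eLpNorm_sum_le (fun k _ => ((hd t k).const_smul _).sub ((hd s k).const_smul _))
      (by norm_num)).trans ?_
    refine Finset.sum_le_sum fun k _ => ?_
    refine (eLpNorm_sub_le ((hd t k).const_smul _) ((hd s k).const_smul _) (by norm_num)).trans ?_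
    rw [eLpNorm_const_smul, eLpNorm_const_smul]
  · refine hc Ω P _ (hasGaussianLaw_sum_wienerSum hβ hind F t s (f t) (f s) a b n) ?_
    have := hind.isProbabilityMeasure
    have hWi : ∀ t k, Integrable (W t k n) P := fun t k => (hW t k n).integrable (by norm_num)
    rw [integral_finsetSum _ fun k _ => by
      exact ((hWi t k).const_mul _).sub ((hWi s k).const_mul _)]
    refine Finset.sum_eq_zero fun k _ => ?_
    rw [integral_sub ((hWi t k).const_mul _) ((hWi s k).const_mul _), integral_const_mul,
      integral_const_mul, integral_wienerSum (hβ k), integral_wienerSum (hβ k)]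
    simp

/-! ### Continuous versions of the modes -/

/-- The pathwise Wiener integral `∫₀ᵗ exp(-(t-r)c) db(r)`, after integration by parts. -/
def ouPath (c : ℝ) (b : ℝ≥0 → ℝ) (t : ℝ) : ℝ :=
  b t.toNNReal - c * Real.exp (-(t * c)) * ∫ r in (0 : ℝ)..t, Real.exp (r * c) * b r.toNNReal

theorem continuous_ouPath (c : ℝ) {b : ℝ≥0 → ℝ} (hb : Continuous b) : Continuous (ouPath c b) := by
  unfold ouPath
  have h1 : Continuous fun t : ℝ => ∫ r in (0 : ℝ)..t, Real.exp (r * c) * b r.toNNReal :=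
    intervalIntegral.continuous_primitive
      (fun x y => Continuous.intervalIntegrable (by fun_prop) x y) 0
  fun_prop

/-- Summation by parts moves the increments from the rough path to the smooth exponential, after
which the Riemann sums converge along every continuous path starting at 0. -/
theorem tendsto_wienerSum_ouPath {Ω : Type*} (B : ℝ≥0 → Ω → ℝ) (ω : Ω)
    (hb : Continuous fun s => B s ω) (h0 : B 0 ω = 0) (c : ℝ) (t : ℝ≥0) :
    Tendsto (fun n => wienerSum B (fun s => Real.exp (-((t : ℝ) - s) * c)) t n ω) atTop
      (𝓝 (ouPath c (fun s => B s ω) t)) := by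
  set h : ℝ → ℝ := fun r => B r.toNNReal ω with hh
  have hhc : Continuous h := hb.comp continuous_real_toNNReal
  set f : ℝ → ℝ := fun r => Real.exp (-((t : ℝ) - r) * c) with hf
  have hfc : Continuous f := by fun_prop
  have hfd : ∀ r, HasDerivAt f (f r * c) r := by
    intro r
    have h1 : HasDerivAt (fun r : ℝ => -((t : ℝ) - r) * c) c r := by
      have := (((hasDerivAt_id r).const_sub (t : ℝ)).neg).mul_const c
      simpa using this
    exact h1.exp
  have hou : ouPath c (fun s => B s ω) t = h t - ∫ r in (0 : ℝ)..t, h r * (f r * c) := by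
    rw [ouPath, mul_assoc, ← intervalIntegral.integral_const_mul,
      ← intervalIntegral.integral_const_mul]
    congr 1
    refine intervalIntegral.integral_congr fun r _ => ?_
    have : f r = Real.exp (-(t * c)) * Real.exp (r * c) := by
      simp only [hf, ← Real.exp_add]
      congr 1
      ring
    simp only [this, hh]
    ring
  obtain ⟨C, hC⟩ := (isCompact_Icc (a := (0 : ℝ)) (b := t)).exists_bound_of_continuousOn
    (f := fun r => f r * c) (by fun_prop)
  have hC0 : 0 ≤ C := (norm_nonneg _).trans (hC 0 ⟨le_rfl, t.2⟩)
  have hu : UniformContinuousOn h (Icc 0 t) :=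
    isCompact_Icc.uniformContinuousOn_of_continuous hhc.continuousOn
  rw [Metric.tendsto_atTop]
  intro ε hε
  obtain ⟨η, hη, hηε⟩ : ∃ η : ℝ, 0 < η ∧ η * C * t < ε :=
    ⟨ε / (2 * (C * t + 1)), by have := t.2; positivity, by
      have : (0 : ℝ) < C * t + 1 := by have := t.2; positivity
      rw [mul_assoc, div_mul_eq_mul_div, div_lt_iff₀ (by positivity)]
      nlinarith⟩
  obtain ⟨d, hd, hd'⟩ := Metric.uniformContinuousOn_iff.1 hu η hη
  obtain ⟨N, hN⟩ := exists_nat_gt (t / d : ℝ)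
  refine ⟨N + 1, fun n hn => ?_⟩
  have hn0 : (0 : ℝ) < n := by exact_mod_cast (by omega : 0 < n)
  have htn : (t : ℝ) / n < d := by
    have h2 : (N : ℝ) ≤ n := by exact_mod_cast (by omega : N ≤ n)
    have h1 : t / d < (n : ℝ) := hN.trans_le h2
    rw [div_lt_iff₀ hd] at h1
    rw [div_lt_iff₀ hn0]
    linarith
  set τ : ℕ → ℝ := fun i => t * i / n with hτ
  have hτ0 : τ 0 = 0 := by simp [hτ]
  have hτn : τ n = t := by simp [hτ, hn0.ne']
  have hτs : ∀ i, τ (i + 1) - τ i = t / n := fun i => by simp only [hτ]; push_cast; ring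
  have hτle : ∀ i, τ i ≤ τ (i + 1) := fun i => by
    have := hτs i
    have h3 : 0 ≤ (t : ℝ) / n := by positivity
    linarith
  have hW : wienerSum B (fun s => Real.exp (-((t : ℝ) - s) * c)) t n ω =
      ∑ i ∈ Finset.range n, f (τ i) * (h (τ (i + 1)) - h (τ i)) := by
    refine Finset.sum_congr rfl fun i _ => ?_
    have e1 : (τ i).toNNReal = t * i / n := by
      have : τ i = ((t * i / n : ℝ≥0) : ℝ) := by simp [hτ]
      rw [this, Real.toNNReal_coe]
    have e2 : (τ (i + 1)).toNNReal = t * (i + 1) / n := by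
      have : τ (i + 1) = ((t * (i + 1) / n : ℝ≥0) : ℝ) := by simp [hτ]
      rw [this, Real.toNNReal_coe]
    have e3 : (((t * i / n : ℝ≥0) : ℝ)) = τ i := by simp [hτ]
    simp only [hh, hf, e1, e2, e3]
  -- The boundary terms reduce to h(t), because f(t) = 1 and h(0) = 0.
  have hparts : ∑ i ∈ Finset.range n, f (τ i) * (h (τ (i + 1)) - h (τ i)) =
      h t - ∑ i ∈ Finset.range n, h (τ (i + 1)) * (f (τ (i + 1)) - f (τ i)) := by
    rw [eq_sub_iff_add_eq, ← Finset.sum_add_distrib]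
    have := Finset.sum_range_sub (fun i => f (τ i) * h (τ i)) n
    rw [hτ0, hτn] at this
    have hh0 : h 0 = 0 := by simp [hh, h0]
    have hft : f t = 1 := by simp [hf]
    rw [hh0, mul_zero, sub_zero, hft, one_mul] at this
    rw [← this]
    exact Finset.sum_congr rfl fun i _ => by ring
  have hI : ∀ (u : ℝ → ℝ) (_ : Continuous u) (x y : ℝ), IntervalIntegrable u volume x y :=
    fun u hu x y => hu.intervalIntegrable x y
  have hsum : ∫ r in (0 : ℝ)..t, h r * (f r * c) =
      ∑ i ∈ Finset.range n, ∫ r in (τ i)..(τ (i + 1)), h r * (f r * c) := by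
    rw [intervalIntegral.sum_integral_adjacent_intervals fun i _ =>
      hI _ (by fun_prop) _ _, hτ0, hτn]
  have hftc : ∀ i, h (τ (i + 1)) * (f (τ (i + 1)) - f (τ i)) =
      ∫ r in (τ i)..(τ (i + 1)), h (τ (i + 1)) * (f r * c) := by
    intro i
    rw [intervalIntegral.integral_const_mul,
      intervalIntegral.integral_eq_sub_of_hasDerivAt (fun r _ => hfd r) (hI _ (by fun_prop) _ _)]
  rw [hW, hparts, hou, hsum, Real.dist_eq, sub_sub_sub_cancel_left, ← Finset.sum_sub_distrib]
  refine lt_of_le_of_lt ((Finset.abs_sum_le_sum_abs _ _).trans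
    (Finset.sum_le_sum (g := fun _ => η * C * (t / n)) fun i hi => ?_)) ?_
  · rw [hftc, ← intervalIntegral.integral_sub (hI _ (by fun_prop) _ _) (hI _ (by fun_prop) _ _)]
    have hin : i + 1 ≤ n := by have := Finset.mem_range.1 hi; omega
    have hmem : ∀ j, j ≤ n → 0 ≤ τ j ∧ τ j ≤ t := by
      intro j hj
      refine ⟨by positivity, ?_⟩
      simp only [hτ]
      rw [div_le_iff₀ hn0]
      have : (j : ℝ) ≤ n := by exact_mod_cast hj
      gcongr
    have := intervalIntegral.norm_integral_le_of_norm_le_const (a := τ i) (b := τ (i + 1))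
      (f := fun r => h r * (f r * c) - h (τ (i + 1)) * (f r * c)) (C := η * C) fun r hr => ?_
    · rwa [hτs, abs_of_nonneg (by positivity)] at this
    · rw [uIoc_of_le (hτle i)] at hr
      have hr0 : r ∈ Icc (0 : ℝ) t :=
        ⟨(hmem i (by omega)).1.trans hr.1.le, hr.2.trans (hmem (i + 1) hin).2⟩
      rw [← sub_mul, norm_mul]
      refine mul_le_mul ?_ (hC r hr0) (norm_nonneg _) hη.le
      refine (hd' r hr0 _ ⟨(hmem (i + 1) hin).1, (hmem (i + 1) hin).2⟩ ?_).le
      rw [Real.dist_eq, abs_sub_comm, abs_of_nonneg (by linarith [hr.2])]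
      have := hτs i
      linarith [hr.1]
  · rw [Finset.sum_const, Finset.card_range, nsmul_eq_mul]
    calc (n : ℝ) * (η * C * (t / n)) = η * C * t := by field_simp
      _ < ε := hηε

open Classical in
/-- A continuous version of the `k`-th mode of the stochastic convolution. -/
def modePath {Ω : Type*} (β : Freq → ℝ≥0 → Ω → ℝ) (L : ℝ) (k : Freq) (ω : Ω) : C(ℝ, ℝ) :=
  if h : Continuous (β k · ω) then ⟨ouPath (eigenvalue L k ^ 2) (β k · ω), continuous_ouPath _ h⟩
  else 0

/-- The same Riemann sums converge pathwise to the one and in L² to the other; an almost surely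
convergent subsequence identifies the limits. -/
theorem modePath_ae_eq {Ω : Type*} [MeasurableSpace Ω] {P : Measure Ω} {β : Freq → ℝ≥0 → Ω → ℝ}
    (hβ : ∀ k, IsBrownianReal (β k) P) (L : ℝ) (k : Freq) (t : ℝ≥0) :
    (fun ω => modePath β L k ω t) =ᵐ[P] modeConvolution P β L k t := by
  have hW := hasWienerIntegral_modeConvolution hβ L k t
  obtain ⟨φ, hφ, hae⟩ := (tendstoInMeasure_of_tendsto_eLpNorm (by norm_num)
    (fun n => (memLp_wienerSum (hβ k) _ t n).aestronglyMeasurable) hW.1.aestronglyMeasurable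
    hW.2).exists_seq_tendsto_ae
  filter_upwards [hae, (hβ k).cont, (hβ k).eval_zero_ae_eq_zero] with ω h1 h2 h3
  rw [modePath, dif_pos h2]
  exact tendsto_nhds_unique
    ((tendsto_wienerSum_ouPath (β k) ω h2 h3 _ t).comp hφ.tendsto_atTop) h1

/-! ### Estimates for the Fourier basis -/

/-- The derivative of `basis1D`. -/
def basis1DDeriv (L : ℝ) (j : ℤ) (z : ℝ) : ℝ :=
  if 0 < j then √(2 / L) * (2 * Real.pi * j / L) * Real.cos (2 * Real.pi * j / L * z)
  else if j = 0 then 0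
  else -(√(2 / L) * (2 * Real.pi * j / L) * Real.sin (2 * Real.pi * j / L * z))

theorem hasDerivAt_basis1D (L : ℝ) (j : ℤ) (z : ℝ) :
    HasDerivAt (basis1D L j) (basis1DDeriv L j z) z := by
  have h : HasDerivAt (fun z : ℝ => 2 * Real.pi * j / L * z) (2 * Real.pi * j / L) z := by
    simpa using (hasDerivAt_id z).const_mul (2 * Real.pi * j / L)
  unfold basis1D basis1DDeriv
  split_ifs
  · exact (h.sin.const_mul √(2 / L)).congr_deriv (by ring)
  · exact hasDerivAt_const _ _
  · exact (h.cos.const_mul √(2 / L)).congr_deriv (by ring)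

theorem abs_basis1D_le {L : ℝ} (hL : 0 < L) (j : ℤ) (z : ℝ) : |basis1D L j z| ≤ √(2 / L) := by
  unfold basis1D
  split_ifs
  · rw [abs_mul, abs_of_nonneg (Real.sqrt_nonneg _)]
    exact mul_le_of_le_one_right (Real.sqrt_nonneg _) (Real.abs_sin_le_one _)
  · rw [abs_of_nonneg (by positivity), ← Real.sqrt_one, ← Real.sqrt_div zero_le_one]
    gcongr
    norm_num
  · rw [abs_mul, abs_of_nonneg (Real.sqrt_nonneg _)]
    exact mul_le_of_le_one_right (Real.sqrt_nonneg _) (Real.abs_cos_le_one _)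

theorem abs_frequency {L : ℝ} (hL : 0 < L) (j : ℤ) :
    |2 * Real.pi * j / L| = 2 * Real.pi / L * |(j : ℝ)| := by
  rw [abs_div, abs_mul, abs_of_pos hL, abs_of_pos Real.two_pi_pos]
  ring

theorem abs_basis1DDeriv_le {L : ℝ} (hL : 0 < L) (j : ℤ) (z : ℝ) :
    |basis1DDeriv L j z| ≤ √(2 / L) * (2 * Real.pi / L * |(j : ℝ)|) := by
  have h0 : 0 ≤ 2 * Real.pi / L * |(j : ℝ)| := by have := Real.pi_pos; positivity
  unfold basis1DDeriv
  split_ifs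
  · rw [abs_mul, abs_mul, abs_of_nonneg (Real.sqrt_nonneg _), abs_frequency hL]
    exact mul_le_of_le_one_right (by positivity) (Real.abs_cos_le_one _)
  · rw [abs_zero]; positivity
  · rw [abs_neg, abs_mul, abs_mul, abs_of_nonneg (Real.sqrt_nonneg _), abs_frequency hL]
    exact mul_le_of_le_one_right (by positivity) (Real.abs_sin_le_one _)

theorem abs_basis1D_sub_le {L : ℝ} (hL : 0 < L) (j : ℤ) (x y : ℝ) :
    |basis1D L j x - basis1D L j y| ≤ √(2 / L) * (2 * Real.pi / L * |(j : ℝ)|) * |x - y| :=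
  Convex.norm_image_sub_le_of_norm_hasDerivWithin_le (s := univ)
    (fun z _ => (hasDerivAt_basis1D L j z).hasDerivWithinAt)
    (fun z _ => abs_basis1DDeriv_le hL j z) convex_univ (mem_univ y) (mem_univ x)

theorem abs_basis1DDeriv_sub_le {L : ℝ} (hL : 0 < L) (j : ℤ) (x y : ℝ) :
    |basis1DDeriv L j x - basis1DDeriv L j y| ≤
      √(2 / L) * (2 * Real.pi / L * |(j : ℝ)|) ^ 2 * |x - y| := by
  have h0 : 0 ≤ 2 * Real.pi / L * |(j : ℝ)| := by have := Real.pi_pos; positivity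
  set w := 2 * Real.pi * j / L with hw
  have hlin : ∀ x y : ℝ, |w * x - w * y| = 2 * Real.pi / L * |(j : ℝ)| * |x - y| := fun x y => by
    rw [← mul_sub, abs_mul, hw, abs_frequency hL]
  unfold basis1DDeriv
  split_ifs
  · rw [← mul_sub, abs_mul, abs_mul, abs_of_nonneg (Real.sqrt_nonneg _),
      abs_frequency hL]
    exact (mul_le_mul_of_nonneg_left ((Real.abs_cos_sub_cos_le _ _).trans_eq (hlin x y))
      (by positivity)).trans_eq (by ring)
  · rw [sub_self, abs_zero]; positivity
  · rw [← neg_sub', abs_neg, ← mul_sub, abs_mul, abs_mul, abs_of_nonneg (Real.sqrt_nonneg _),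
      abs_frequency hL]
    exact (mul_le_mul_of_nonneg_left ((Real.abs_sin_sub_sin_le _ _).trans_eq (hlin x y))
      (by positivity)).trans_eq (by ring)

theorem abs_fst_le_freqNorm (k : Freq) : |(k.1.1 : ℝ)| ≤ freqNorm k :=
  Real.abs_le_sqrt (by nlinarith [sq_nonneg (k.1.2 : ℝ)])

theorem abs_snd_le_freqNorm (k : Freq) : |(k.1.2 : ℝ)| ≤ freqNorm k :=
  Real.abs_le_sqrt (by nlinarith [sq_nonneg (k.1.1 : ℝ)])

/-- The basis function `e_k` (for `j = 0`) and its partial derivatives (for `j = 1, 2`). -/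
def basisJet (L : ℝ) (k : Freq) : Fin 3 → ℝ → ℝ → ℝ
  | 0, x, y => basis1D L k.1.1 x * basis1D L k.1.2 y
  | 1, x, y => basis1DDeriv L k.1.1 x * basis1D L k.1.2 y
  | 2, x, y => basis1D L k.1.1 x * basis1DDeriv L k.1.2 y

theorem continuous_basis1D (L : ℝ) (j : ℤ) : Continuous (basis1D L j) :=
  continuous_iff_continuousAt.2 fun z => (hasDerivAt_basis1D L j z).continuousAt

theorem continuous_basis1DDeriv (L : ℝ) (j : ℤ) : Continuous (basis1DDeriv L j) := by
  unfold basis1DDeriv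
  split_ifs <;> fun_prop

theorem continuous_basisJet (L : ℝ) (k : Freq) (j : Fin 3) :
    Continuous fun q : ℝ × ℝ => basisJet L k j q.1 q.2 := by
  have h1 := continuous_basis1D L
  have h2 := continuous_basis1DDeriv L
  fin_cases j <;> simp only [basisJet] <;> fun_prop

theorem abs_mul_sub_mul_le {a b c d A B A' B' D : ℝ} (h1 : |a| ≤ A) (h2 : |d| ≤ B)
    (h3 : |a - c| ≤ A' * D) (h4 : |b - d| ≤ B' * D) :
    |a * b - c * d| ≤ (A * B' + A' * B) * D := by
  have e : a * b - c * d = a * (b - d) + (a - c) * d := by ring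
  have hA : 0 ≤ A := (abs_nonneg _).trans h1
  have hAD : 0 ≤ A' * D := (abs_nonneg _).trans h3
  calc |a * b - c * d| ≤ |a| * |b - d| + |a - c| * |d| := by
        rw [e, ← abs_mul, ← abs_mul]; exact abs_add_le _ _
    _ ≤ A * (B' * D) + A' * D * B := by gcongr
    _ = _ := by ring

/-- Each derivative costs one factor |k|. The undifferentiated component gets the same, wasteful
bounds, which is allowed since |k| ≥ 1 and lets all three components be handled alike. -/
theorem exists_basisJet_bound {L : ℝ} (hL : 0 < L) : ∃ c : ℝ, 0 < c ∧
    (∀ k j x y, |basisJet L k j x y| ≤ c * freqNorm k) ∧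
    (∀ k j x y x' y' D, |x - x'| ≤ D → |y - y'| ≤ D →
      |basisJet L k j x y - basisJet L k j x' y'| ≤ 2 * c * freqNorm k * (freqNorm k * D)) := by
  set A := √(2 / L) with hA
  set w := 2 * Real.pi / L with hw
  have hA0 : 0 < A := by positivity
  have hw0 : 0 < w := by have := Real.pi_pos; positivity
  have h1 : A ^ 2 ≤ A ^ 2 * (1 + w) ^ 2 := le_mul_of_one_le_right (by positivity) (by nlinarith)
  have h2 : A ^ 2 * w ≤ A ^ 2 * (1 + w) ^ 2 := by gcongr; nlinarith
  have h3 : A ^ 2 * w ^ 2 ≤ A ^ 2 * (1 + w) ^ 2 := by gcongr; linarith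
  -- This constant dominates A², A²w and A²w², the amplitudes with zero, one and two frequency
  -- factors.
  refine ⟨A ^ 2 * (1 + w) ^ 2, by positivity, ?_, ?_⟩
  · intro k j x y
    have hκ := one_le_freqNorm k
    have hk1 := abs_fst_le_freqNorm k
    have hk2 := abs_snd_le_freqNorm k
    have b1 := abs_basis1D_le hL k.1.1 x
    have b2 := abs_basis1D_le hL k.1.2 y
    have d1 : |basis1DDeriv L k.1.1 x| ≤ A * (w * freqNorm k) :=
      (abs_basis1DDeriv_le hL k.1.1 x).trans (by gcongr)
    have d2 : |basis1DDeriv L k.1.2 y| ≤ A * (w * freqNorm k) :=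
      (abs_basis1DDeriv_le hL k.1.2 y).trans (by gcongr)
    fin_cases j <;> simp only [basisJet] <;> rw [abs_mul]
    · calc |basis1D L k.1.1 x| * |basis1D L k.1.2 y| ≤ A * A := by gcongr
        _ = A ^ 2 * 1 := by ring
        _ ≤ _ := by gcongr
    · calc |basis1DDeriv L k.1.1 x| * |basis1D L k.1.2 y| ≤ (A * (w * freqNorm k)) * A := by gcongr
        _ = A ^ 2 * w * freqNorm k := by ring
        _ ≤ _ := by gcongr
    · calc |basis1D L k.1.1 x| * |basis1DDeriv L k.1.2 y| ≤ A * (A * (w * freqNorm k)) := by gcongr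
        _ = A ^ 2 * w * freqNorm k := by ring
        _ ≤ _ := by gcongr
  · intro k j x y x' y' D hx hy
    have hD : 0 ≤ D := (abs_nonneg _).trans hx
    have hκ := one_le_freqNorm k
    set κ := freqNorm k
    have hk1 : |(k.1.1 : ℝ)| ≤ κ := abs_fst_le_freqNorm k
    have hk2 : |(k.1.2 : ℝ)| ≤ κ := abs_snd_le_freqNorm k
    have hb1 := abs_basis1D_le hL k.1.1 x
    have hb2 := abs_basis1D_le hL k.1.2 y'
    have hd1 : |basis1DDeriv L k.1.1 x| ≤ A * (w * κ) :=
      (abs_basis1DDeriv_le hL k.1.1 x).trans (by gcongr)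
    have hd2 : |basis1DDeriv L k.1.2 y'| ≤ A * (w * κ) :=
      (abs_basis1DDeriv_le hL k.1.2 y').trans (by gcongr)
    have b1 : |basis1D L k.1.1 x - basis1D L k.1.1 x'| ≤ A * (w * κ) * D :=
      (abs_basis1D_sub_le hL _ _ _).trans (by gcongr)
    have b2 : |basis1D L k.1.2 y - basis1D L k.1.2 y'| ≤ A * (w * κ) * D :=
      (abs_basis1D_sub_le hL _ _ _).trans (by gcongr)
    have d1 : |basis1DDeriv L k.1.1 x - basis1DDeriv L k.1.1 x'| ≤ A * (w * κ) ^ 2 * D :=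
      (abs_basis1DDeriv_sub_le hL _ _ _).trans (by gcongr)
    have d2 : |basis1DDeriv L k.1.2 y - basis1DDeriv L k.1.2 y'| ≤ A * (w * κ) ^ 2 * D :=
      (abs_basis1DDeriv_sub_le hL _ _ _).trans (by gcongr)
    fin_cases j <;> simp only [basisJet]
    · calc _ ≤ _ := abs_mul_sub_mul_le hb1 hb2 b1 b2
        _ = 2 * (A ^ 2 * w) * 1 * (κ * D) := by ring
        _ ≤ _ := by gcongr
    · calc _ ≤ _ := abs_mul_sub_mul_le hd1 hb2 d1 b2
        _ = 2 * (A ^ 2 * w ^ 2) * κ * (κ * D) := by ring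
        _ ≤ _ := by gcongr
    · calc _ ≤ _ := abs_mul_sub_mul_le hb1 hd2 b1 d2
        _ = 2 * (A ^ 2 * w ^ 2) * κ * (κ * D) := by ring
        _ ≤ _ := by gcongr

/-- Interpolation: a quantity that is both bounded and Lipschitz is Hölder of every intermediate
order. -/
theorem min_one_le_rpow {x η : ℝ} (hx : 0 ≤ x) (h0 : 0 < η) (h1 : η ≤ 1) : min 1 x ≤ x ^ η := by
  rcases le_total x 1 with h | h
  · rw [min_eq_right h]
    exact Real.self_le_rpow_of_le_one hx h h1
  · rw [min_eq_left h]
    exact Real.one_le_rpow h h0.le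

/-- The squared jet is of order at most |k|², so division by μ_k² leaves μ_k^(-1). A displacement D
contributes (|k|D)^(2δ) through space and (μ_k² D)^(2δ) through time. The temporal factor dictates
the weight μ_k^(4δ); the spatial one is absorbed since |k| ≥ 1. -/
theorem exists_jet_variance_bound {L δ : ℝ} (hL : 0 < L) (h0 : 0 < δ) (h1 : δ < 1 / 4) :
    ∃ C : ℝ, 0 < C ∧
      (∀ k j x y, basisJet L k j x y ^ 2 / eigenvalue L k ^ 2 ≤
        C * eigenvalue L k ^ (4 * δ - 1)) ∧
      ∀ k j x y x' y' t s D, |t - s| ≤ D → |x - x'| ≤ D → |y - y'| ≤ D →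
        ((basisJet L k j x y - basisJet L k j x' y') ^ 2 + 2 * basisJet L k j x' y' ^ 2 *
          (1 - Real.exp (-(eigenvalue L k ^ 2 * |t - s|)))) / eigenvalue L k ^ 2 ≤
          C * (D ^ δ) ^ 2 * eigenvalue L k ^ (4 * δ - 1) := by
  obtain ⟨c, hc, hb, hl⟩ := exists_basisJet_bound hL
  set w := 2 * Real.pi / L with hw
  have hw0 : 0 < w := by have := Real.pi_pos; positivity
  have hμ : ∀ k, eigenvalue L k = (w * freqNorm k) ^ 2 := fun k => by
    rw [eigenvalue, hw]; ring
  have hμδ : ∀ k, eigenvalue L k ^ (4 * δ) = w ^ (8 * δ) * freqNorm k ^ (8 * δ) := by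
    intro k
    have := one_le_freqNorm k
    rw [hμ, ← Real.rpow_natCast, ← Real.rpow_mul (by positivity),
      ← Real.mul_rpow (by positivity) (by positivity)]
    congr 1
    push_cast
    ring
  have hdiv : ∀ k (X Y : ℝ), X ≤ Y * eigenvalue L k ^ (4 * δ) * freqNorm k ^ 2 →
      X / eigenvalue L k ^ 2 ≤ Y / w ^ 2 * eigenvalue L k ^ (4 * δ - 1) := by
    intro k X Y h
    have hm := eigenvalue_pos hL k
    rw [Real.rpow_sub_one hm.ne', div_le_iff₀ (by positivity)]
    refine h.trans (le_of_eq ?_)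
    have : freqNorm k ^ 2 = eigenvalue L k / w ^ 2 := by rw [hμ]; field_simp
    rw [this]
    field_simp
  set W := w ^ (8 * δ) with hW
  have hW0 : 0 < W := by positivity
  -- The first term pays for spatial increments, W converting |k|^(8δ) into μ_k^(4δ); the second
  -- pays for temporal ones.
  set C₀ := (4 * c ^ 2 / W + 2 * c ^ 2) with hC₀
  refine ⟨C₀ / w ^ 2, by positivity, fun k j x y => hdiv _ _ _ ?_, ?_⟩
  · have hκ := one_le_freqNorm k
    rw [hμδ]
    have hκ8 : 1 ≤ freqNorm k ^ (8 * δ) := Real.one_le_rpow hκ (by positivity)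
    calc basisJet L k j x y ^ 2 = |basisJet L k j x y| ^ 2 := (sq_abs _).symm
      _ ≤ (c * freqNorm k) ^ 2 := by gcongr; exact hb k j x y
      _ = c ^ 2 / W * (W * 1) * freqNorm k ^ 2 := by field_simp
      _ ≤ C₀ * (W * freqNorm k ^ (8 * δ)) * freqNorm k ^ 2 := by
        gcongr
        rw [hC₀]
        have : 0 ≤ c ^ 2 / W := by positivity
        have : 4 * c ^ 2 / W = 4 * (c ^ 2 / W) := by ring
        nlinarith [sq_nonneg c]
  · intro k j x y x' y' t s D ht hx hy
    have hD : 0 ≤ D := (abs_nonneg _).trans ht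
    have hκ := one_le_freqNorm k
    have hm := eigenvalue_pos hL k
    rw [div_mul_eq_mul_div]
    refine hdiv _ _ _ ?_
    have e1 : (basisJet L k j x y - basisJet L k j x' y') ^ 2 ≤
        4 * c ^ 2 * freqNorm k ^ 2 * (freqNorm k ^ (8 * δ) * (D ^ δ) ^ 2) := by
      have g1 : |basisJet L k j x y - basisJet L k j x' y'| ≤
          2 * c * freqNorm k * (freqNorm k * D) ^ δ := by
        refine le_trans ?_ (mul_le_mul_of_nonneg_left
          (min_one_le_rpow (by positivity) h0 (by linarith)) (by positivity))
        rw [mul_min_of_nonneg _ _ (by positivity)]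
        refine le_min ?_ (hl k j x y x' y' D hx hy)
        refine (abs_sub _ _).trans ?_
        linarith [hb k j x y, hb k j x' y']
      calc (basisJet L k j x y - basisJet L k j x' y') ^ 2
          = |basisJet L k j x y - basisJet L k j x' y'| ^ 2 := (sq_abs _).symm
        _ ≤ (2 * c * freqNorm k * (freqNorm k * D) ^ δ) ^ 2 := by gcongr
        _ = 4 * c ^ 2 * freqNorm k ^ 2 * (freqNorm k ^ (2 * δ) * (D ^ δ) ^ 2) := by
          rw [Real.mul_rpow (by positivity) hD, mul_comm 2 δ, Real.rpow_mul (by positivity)]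
          norm_cast
          ring
        _ ≤ _ := by
          gcongr
          norm_num
    have e2 : 1 - Real.exp (-(eigenvalue L k ^ 2 * |t - s|)) ≤
        eigenvalue L k ^ (4 * δ) * (D ^ δ) ^ 2 := by
      set z := eigenvalue L k ^ 2 * |t - s| with hz
      have hz0 : 0 ≤ z := by positivity
      calc 1 - Real.exp (-z) ≤ min 1 z := by
            refine le_min (by linarith [Real.exp_pos (-z)]) ?_
            linarith [Real.add_one_le_exp (-z)]
        _ ≤ z ^ (2 * δ) := min_one_le_rpow hz0 (by positivity) (by linarith)
        _ ≤ (eigenvalue L k ^ 2 * D) ^ (2 * δ) := by rw [hz]; gcongr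
        _ = _ := by
          rw [Real.mul_rpow (by positivity) hD, ← Real.rpow_natCast (eigenvalue L k),
            ← Real.rpow_mul hm.le, mul_comm 2 δ, Real.rpow_mul hD, ← Real.rpow_natCast (D ^ δ)]
          congr 2
          push_cast
          ring
    have e3 : basisJet L k j x' y' ^ 2 ≤ c ^ 2 * freqNorm k ^ 2 := by
      rw [← sq_abs, ← mul_pow]
      gcongr
      exact hb k j x' y'
    have e4 : 0 ≤ 1 - Real.exp (-(eigenvalue L k ^ 2 * |t - s|)) := by
      rw [sub_nonneg, Real.exp_le_one_iff]
      have : 0 ≤ eigenvalue L k ^ 2 * |t - s| := by positivity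
      linarith
    calc _ ≤ 4 * c ^ 2 * freqNorm k ^ 2 * (freqNorm k ^ (8 * δ) * (D ^ δ) ^ 2) +
          2 * (c ^ 2 * freqNorm k ^ 2) * (eigenvalue L k ^ (4 * δ) * (D ^ δ) ^ 2) := by
          gcongr
      _ = _ := by
          rw [hC₀, hμδ]
          field_simp

/-! ### The random field and its derivatives -/

/-- The `k`-th term of the stochastic convolution together with its spatial derivatives. -/
def fieldMode {Ω : Type*} (β : Freq → ℝ≥0 → Ω → ℝ) (L T a : ℝ) (k : Freq) (ω : Ω) :
    C(SpaceTime T L × Fin 3, ℝ) where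
  toFun x := a * modePath β L k ω x.1.1 * basisJet L k x.2 x.1.2.1 x.1.2.2
  continuous_toFun := by
    refine continuous_prod_of_discrete_right.2 fun j => ?_
    have h := continuous_basisJet L k j
    have h1 : Continuous fun q : SpaceTime T L => basisJet L k j q.2.1 q.2.2 :=
      h.comp (by fun_prop : Continuous fun q : SpaceTime T L => ((q.2.1 : ℝ), (q.2.2 : ℝ)))
    have h2 : Continuous fun q : SpaceTime T L => modePath β L k ω q.1 :=
      (modePath β L k ω).continuous.comp (by fun_prop)
    exact (continuous_const.mul h2).mul h1

theorem eLpNorm_two_le {Ω : Type*} [MeasurableSpace Ω] {P : Measure Ω} {X : Ω → ℝ}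
    (hX : MemLp X 2 P) {V : ℝ} (hV : ∫ ω, X ω ^ 2 ∂P ≤ V) :
    eLpNorm X 2 P ≤ ENNReal.ofReal √V := by
  rw [hX.eLpNorm_eq_integral_rpow_norm (by norm_num) (by norm_num)]
  refine ENNReal.ofReal_le_ofReal ?_
  simp only [ENNReal.toReal_ofNat, Real.rpow_two, Real.norm_eq_abs, sq_abs]
  rw [Real.sqrt_eq_rpow, one_div]
  exact Real.rpow_le_rpow (integral_nonneg fun _ => sq_nonneg _) hV (by norm_num)

section Field

variable {Ω : Type*} [MeasurableSpace Ω] {P : Measure Ω} {β : Freq → ℝ≥0 → Ω → ℝ}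

theorem fieldMode_ae_eq (hβ : ∀ k, IsBrownianReal (β k) P) (L T a : ℝ) (k : Freq)
    (x : SpaceTime T L × Fin 3) :
    (fun ω => fieldMode β L T a k ω x) =ᵐ[P] fun ω =>
      a * basisJet L k x.2 x.1.2.1 x.1.2.2 *
        modeConvolution P β L k (x.1.1 : ℝ).toNNReal ω := by
  filter_upwards [modePath_ae_eq hβ L k (x.1.1 : ℝ).toNNReal] with ω h
  rw [Real.coe_toNNReal _ x.1.1.2.1] at h
  rw [← h]
  simp only [fieldMode, ContinuousMap.coe_mk]
  ring

theorem aemeasurable_fieldMode (hβ : ∀ k, IsBrownianReal (β k) P) (L T a : ℝ) (k : Freq)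
    (x : SpaceTime T L × Fin 3) : AEMeasurable (fun ω => fieldMode β L T a k ω x) P :=
  AEMeasurable.congr
    (((memLp_modeConvolution hβ L k _).aestronglyMeasurable.aemeasurable).const_mul _)
    (fieldMode_ae_eq hβ L T a k x).symm

theorem sum_fieldMode_ae_eq (hβ : ∀ k, IsBrownianReal (β k) P) (L T : ℝ) (a : Freq → ℝ)
    (F : Finset Freq) (x : SpaceTime T L × Fin 3) :
    (fun ω => (∑ k ∈ F, fieldMode β L T (a k) k ω) x) =ᵐ[P] fun ω =>
      ∑ k ∈ F, a k * basisJet L k x.2 x.1.2.1 x.1.2.2 *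
        modeConvolution P β L k (x.1.1 : ℝ).toNNReal ω := by
  filter_upwards [ae_all_iff.2 fun k => fieldMode_ae_eq hβ L T (a k) k x] with ω h
  simp only [ContinuousMap.coe_sum, Finset.sum_apply, h]

theorem aestronglyMeasurable_sum_fieldMode (hβ : ∀ k, IsBrownianReal (β k) P) {L T : ℝ}
    (hL : 0 < L) (hT : 0 < T) (a : Freq → ℝ) (F : Finset Freq) :
    AEStronglyMeasurable (fun ω => ∑ k ∈ F, fieldMode β L T (a k) k ω) P := by
  have : Nonempty (Icc (0 : ℝ) T) := ⟨⟨0, le_rfl, hT.le⟩⟩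
  have : Nonempty (Icc (0 : ℝ) L) := ⟨⟨0, le_rfl, hL.le⟩⟩
  exact Finset.aestronglyMeasurable_fun_sum _ fun k _ => aestronglyMeasurable_continuousMap
    fun x => aemeasurable_fieldMode hβ L T (a k) k x

theorem eLpNorm_two_modes_le (hβ : ∀ k, IsBrownianReal (β k) P)
    (hind : iIndepFun (fun k ω t => β k t ω) P) {L : ℝ} (hL : 0 < L) (F : Finset Freq)
    (t s : ℝ≥0) (a b v : Freq → ℝ)
    (h : ∀ k ∈ F, ((a k - b k) ^ 2 + 2 * b k ^ 2 *
      (1 - Real.exp (-(eigenvalue L k ^ 2 * |(t : ℝ) - s|)))) / eigenvalue L k ^ 2 ≤ v k) :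
    eLpNorm (fun ω => ∑ k ∈ F, (a k * modeConvolution P β L k t ω -
      b k * modeConvolution P β L k s ω)) 2 P ≤ ENNReal.ofReal √(∑ k ∈ F, v k) := by
  refine eLpNorm_two_le (memLp_finsetSum _ fun k _ =>
      ((memLp_modeConvolution hβ L k t).const_mul _).sub
        ((memLp_modeConvolution hβ L k s).const_mul _)) ?_
  refine (integral_sum_modeConvolution_sub_sq hβ hind hL F t s a b).trans_le ?_
  exact Finset.sum_le_sum fun k hk =>
    (integral_modeConvolution_sub_sq_le hβ hind hL k t s _ _).trans (h k hk)

end Field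

/-- Variance, Gaussian comparison and chaining combine here. Since the constant sees neither the
coefficients nor the set of modes, this bound yields both convergence of the series and the final
moment estimate. -/
theorem exists_field_bound {L T : ℝ} (hL : 0 < L) (hT : 0 < T) {δ p : ℝ} (h0 : 0 < δ)
    (h1 : δ < 1 / 4) (hp : 1 ≤ p) :
    ∃ C : ℝ≥0, ∀ (Ω : Type*) [MeasurableSpace Ω] (P : Measure Ω) (β : Freq → ℝ≥0 → Ω → ℝ),
      (∀ k, IsBrownianReal (β k) P) → iIndepFun (fun k ω t => β k t ω) P →
      ∀ (a : Freq → ℝ) (F : Finset Freq),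
        eLpNorm (fun ω => ∑ k ∈ F, fieldMode β L T (a k) k ω) (ENNReal.ofReal p) P ≤
          C * ENNReal.ofReal √(∑ k ∈ F, a k ^ 2 * eigenvalue L k ^ (4 * δ - 1)) := by
  set r := max p (4 / δ) with hr
  have hr1 : 1 ≤ r := hp.trans (le_max_left _ _)
  have hr0 : 0 < r := by linarith
  have hr3 : 3 < r * δ := by
    have : 4 / δ ≤ r := le_max_right _ _
    rw [div_le_iff₀ h0] at this
    linarith
  have hrr : (ENNReal.ofReal r).toReal = r := ENNReal.toReal_ofReal hr0.le
  have hr' : ENNReal.ofReal r ≠ 0 := by simpa using hr0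
  obtain ⟨C₁, hC₁⟩ := exists_sup_bound hL hT h0 hr1 hr3
  obtain ⟨c, hc⟩ := exists_mode_moment_bound (ENNReal.ofReal r) ENNReal.ofReal_ne_top
  obtain ⟨C₂, hC₂, hv1, hv2⟩ := exists_jet_variance_bound hL h0 h1
  refine ⟨C₁ * (c * (√C₂).toNNReal), fun Ω _ P β hβ hind a F => ?_⟩
  have := hind.isProbabilityMeasure
  set A := ∑ k ∈ F, a k ^ 2 * eigenvalue L k ^ (4 * δ - 1) with hA
  have hmc : ∀ (t s : ℝ≥0) (u v w : Freq → ℝ), (∀ k ∈ F, ((u k - v k) ^ 2 + 2 * v k ^ 2 *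
      (1 - Real.exp (-(eigenvalue L k ^ 2 * |(t : ℝ) - s|)))) / eigenvalue L k ^ 2 ≤ w k) →
      eLpNorm' (fun ω => ∑ k ∈ F, (u k * modeConvolution P β L k t ω -
        v k * modeConvolution P β L k s ω)) r P ≤ c * ENNReal.ofReal √(∑ k ∈ F, w k) := by
    intro t s u v w hw
    have e := hc Ω P β hβ hind L F t s u v
    rw [eLpNorm_eq_eLpNorm' hr' ENNReal.ofReal_ne_top, hrr] at e
    refine e.trans ?_
    gcongr
    exact eLpNorm_two_modes_le hβ hind hL F t s u v w hw
  refine (eLpNorm_le_eLpNorm_of_exponent_le (ENNReal.ofReal_le_ofReal (le_max_left p (4 / δ)))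
    (aestronglyMeasurable_sum_fieldMode hβ hL hT a F)).trans ?_
  rw [← hr, eLpNorm_eq_eLpNorm' hr' ENNReal.ofReal_ne_top, hrr]
  refine (hC₁ Ω P _ (c * ENNReal.ofReal √(C₂ * A)) ?_ ?_ ?_).trans (le_of_eq ?_)
  · intro x
    simp only [ContinuousMap.coe_sum, Finset.sum_apply]
    exact Finset.aemeasurable_fun_sum _ fun k _ => aemeasurable_fieldMode hβ L T (a k) k x
  · rintro ⟨⟨t, x, y⟩, j⟩
    rw [eLpNorm'_congr_ae (sum_fieldMode_ae_eq hβ L T a F _)]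
    -- Zero weights on the second point turn the increment estimate into the one-point bound.
    have e := hmc (t : ℝ).toNNReal (t : ℝ).toNNReal (fun k => a k * basisJet L k j x y) 0
      (fun k => C₂ * (a k ^ 2 * eigenvalue L k ^ (4 * δ - 1))) fun k _ => by
        have := mul_le_mul_of_nonneg_left (hv1 k j x y) (sq_nonneg (a k))
        simp only [Pi.zero_apply, sub_zero, ne_eq, OfNat.ofNat_ne_zero, not_false_eq_true,
          zero_pow, mul_zero, zero_mul, add_zero]
        calc _ = a k ^ 2 * (basisJet L k j x y ^ 2 / eigenvalue L k ^ 2) := by ring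
          _ ≤ _ := this
          _ = _ := by ring
    rw [← Finset.mul_sum] at e
    simpa using e
  · rintro ⟨t, x, y⟩ ⟨s, x', y'⟩ j
    set D := dist (t, x, y) (s, x', y') with hD
    have hD0 : 0 ≤ D := dist_nonneg
    have ht : |(t : ℝ) - s| ≤ D := le_max_left _ _
    have hx : |(x : ℝ) - x'| ≤ D := (le_max_left _ _).trans (le_max_right _ _)
    have hy : |(y : ℝ) - y'| ≤ D := (le_max_right _ _).trans (le_max_right _ _)
    refine (eLpNorm'_congr_ae ((sum_fieldMode_ae_eq hβ L T a F ((t, x, y), j)).sub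
      (sum_fieldMode_ae_eq hβ L T a F ((s, x', y'), j)))).trans_le ?_
    have e := hmc (t : ℝ).toNNReal (s : ℝ).toNNReal (fun k => a k * basisJet L k j x y)
      (fun k => a k * basisJet L k j x' y')
      (fun k => (C₂ * (D ^ δ) ^ 2) * (a k ^ 2 * eigenvalue L k ^ (4 * δ - 1))) fun k _ => by
        have := mul_le_mul_of_nonneg_left (hv2 k j x y x' y' t s D ht hx hy) (sq_nonneg (a k))
        rw [Real.coe_toNNReal _ t.2.1, Real.coe_toNNReal _ s.2.1]
        calc _ = a k ^ 2 * (((basisJet L k j x y - basisJet L k j x' y') ^ 2 +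
              2 * basisJet L k j x' y' ^ 2 *
              (1 - Real.exp (-(eigenvalue L k ^ 2 * |(t : ℝ) - s|)))) / eigenvalue L k ^ 2) := by
              ring
          _ ≤ _ := this
          _ = _ := by ring
    rw [← Finset.mul_sum, ← hA, mul_right_comm, Real.sqrt_mul' _ (sq_nonneg _),
      Real.sqrt_sq (by positivity), ENNReal.ofReal_mul (Real.sqrt_nonneg _), ← mul_assoc] at e
    simp only [Finset.sum_sub_distrib] at e
    exact e
  · rw [Real.sqrt_mul hC₂.le, ENNReal.ofReal_mul (Real.sqrt_nonneg _)]
    push_cast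
    rw [ENNReal.ofReal]
    ring

/-! ### Gradients of uniform limits -/

theorem hasGradientAt_basis2D (L : ℝ) (k : Freq) (x : Plane) :
    HasGradientAt (basis2D L k) !₂[basisJet L k 1 (x 0) (x 1), basisJet L k 2 (x 0) (x 1)] x := by
  rw [hasGradientAt_iff_hasFDerivAt]
  have h0 : HasFDerivAt (fun y : Plane => y 0) (EuclideanSpace.proj (0 : Fin 2) : Plane →L[ℝ] ℝ) x :=
    (EuclideanSpace.proj (0 : Fin 2) : Plane →L[ℝ] ℝ).hasFDerivAt
  have h1 : HasFDerivAt (fun y : Plane => y 1) (EuclideanSpace.proj (1 : Fin 2) : Plane →L[ℝ] ℝ) x :=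
    (EuclideanSpace.proj (1 : Fin 2) : Plane →L[ℝ] ℝ).hasFDerivAt
  have h := ((hasDerivAt_basis1D L k.1.1 (x 0)).comp_hasFDerivAt x h0).mul
    ((hasDerivAt_basis1D L k.1.2 (x 1)).comp_hasFDerivAt x h1)
  refine h.congr_fderiv ?_
  ext v
  simp [basisJet, PiLp.inner_apply, Fin.sum_univ_two]
  ring

/-- The gradient components of a jet, as a continuous vector field. -/
def gradPart (T L : ℝ) : C(SpaceTime T L × Fin 3, ℝ) →L[ℝ] C(SpaceTime T L, Plane) :=
  LinearMap.mkContinuous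
    { toFun := fun g => ⟨fun q => !₂[g (q, 1), g (q, 2)], by
        refine (PiLp.continuous_toLp 2 _).comp (continuous_pi fun i => ?_)
        fin_cases i <;> simp <;> fun_prop⟩
      map_add' := fun g h => by
        ext q i
        fin_cases i <;> simp
      map_smul' := fun c g => by
        ext q i
        fin_cases i <;> simp } 2 fun g => by
    rw [ContinuousMap.norm_le _ (by positivity)]
    intro q
    have h1 := g.norm_coe_le_norm (q, 1)
    have h2 := g.norm_coe_le_norm (q, 2)
    rw [Real.norm_eq_abs] at h1 h2
    simp only [LinearMap.coe_mk, AddHom.coe_mk, ContinuousMap.coe_mk, EuclideanSpace.norm_eq,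
      Fin.sum_univ_two, Real.norm_eq_abs, sq_abs]
    refine Real.sqrt_le_iff.2 ⟨by positivity, ?_⟩
    have e1 := sq_le_sq' (abs_le.1 h1).1 (abs_le.1 h1).2
    have e2 := sq_le_sq' (abs_le.1 h2).1 (abs_le.1 h2).2
    simp only [Matrix.cons_val_zero, Matrix.cons_val_one]
    nlinarith [norm_nonneg g]

theorem gradPart_apply {T L : ℝ} (g : C(SpaceTime T L × Fin 3, ℝ)) (q : SpaceTime T L) :
    gradPart T L g q = !₂[g (q, 1), g (q, 2)] := rfl

theorem norm_gradPart_le {T L : ℝ} (g : C(SpaceTime T L × Fin 3, ℝ)) :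
    ‖gradPart T L g‖ ≤ 2 * ‖g‖ :=
  (ContinuousLinearMap.le_opNorm _ _).trans (by
    gcongr
    exact LinearMap.mkContinuous_norm_le _ (by norm_num) _)

/-- The projection of the plane onto the square, at time `t`. -/
def projPoint {T L : ℝ} (hL : 0 ≤ L) (t : Icc (0 : ℝ) T) (x : Plane) : SpaceTime T L :=
  (t, projIcc 0 L hL (x 0), projIcc 0 L hL (x 1))

theorem projPoint_eq {T L : ℝ} (hL : 0 ≤ L) (t : Icc (0 : ℝ) T) {x : Plane} (hx : x ∈ square L) :
    projPoint hL t x = (t, ⟨x 0, hx 0⟩, ⟨x 1, hx 1⟩) := by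
  rw [projPoint, projIcc_of_mem hL (hx 0), projIcc_of_mem hL (hx 1)]

theorem pos_projPoint {T L : ℝ} (hL : 0 ≤ L) (t : Icc (0 : ℝ) T) {x : Plane} (hx : x ∈ square L) :
    (projPoint hL t x).pos = x := by
  rw [projPoint_eq hL t hx]
  ext i
  fin_cases i <;> simp [SpaceTime.pos]

theorem pos_mem_square {T L : ℝ} (q : SpaceTime T L) : q.pos ∈ square L := by
  intro i
  fin_cases i
  · exact q.2.1.2
  · exact q.2.2.2

theorem projPoint_pos {T L : ℝ} (hL : 0 ≤ L) (q : SpaceTime T L) :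
    projPoint hL q.1 q.pos = q := by
  rw [projPoint_eq hL _ (pos_mem_square q)]
  rfl

theorem continuous_projPoint {T L : ℝ} (hL : 0 ≤ L) :
    Continuous fun p : Icc (0 : ℝ) T × Plane => projPoint hL p.1 p.2 := by
  unfold projPoint
  fun_prop

theorem convex_square (L : ℝ) : Convex ℝ (square L) := by
  have : square L = ⋂ i : Fin 2, (fun x : Plane => x i) ⁻¹' Icc 0 L := by
    ext x; simp [square]
  rw [this]
  exact convex_iInter fun i => (convex_Icc 0 L).linear_preimage
    (EuclideanSpace.proj i : Plane →L[ℝ] ℝ).toLinearMap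

/-- `g` consists of a function, differentiable in space, and of its partial derivatives. -/
def IsJet {T L : ℝ} (hL : 0 ≤ L) (g : C(SpaceTime T L × Fin 3, ℝ)) : Prop :=
  ∀ q : SpaceTime T L, HasGradientWithinAt (fun y => g (projPoint hL q.1 y, 0))
    (gradPart T L g q) (square L) q.pos

/-- Differentiation of uniform limits, valid up to the boundary. The mean value inequality is
applied on the convex intersection of the square with a ball where the limiting gradient oscillates
by less than ε; the uniform gradient error vanishes as n grows. -/
theorem isJet_of_tendsto {T L : ℝ} (hL : 0 ≤ L) {J : ℕ → C(SpaceTime T L × Fin 3, ℝ)}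
    {g : C(SpaceTime T L × Fin 3, ℝ)} (hJ : ∀ n, IsJet hL (J n))
    (h : Tendsto J atTop (𝓝 g)) : IsJet hL g := by
  intro q
  rw [hasGradientWithinAt_iff_isLittleO, Asymptotics.isLittleO_iff]
  intro ε hε
  have hcont : Continuous fun y : Plane => gradPart T L g (projPoint hL q.1 y) :=
    (gradPart T L g).continuous.comp
      ((continuous_projPoint hL).comp (by fun_prop : Continuous fun y : Plane => (q.1, y)))
  obtain ⟨r, hr, hrε⟩ := Metric.continuousAt_iff.1 hcont.continuousAt ε hε
  have hconv : Convex ℝ (square L ∩ Metric.ball q.pos r) :=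
    (convex_square L).inter (convex_ball _ _)
  filter_upwards [inter_mem_nhdsWithin (square L) (Metric.ball_mem_nhds q.pos hr)] with y hy
  have hxs : q.pos ∈ square L ∩ Metric.ball q.pos r :=
    ⟨pos_mem_square q, Metric.mem_ball_self hr⟩
  have key : ∀ n, ‖J n (projPoint hL q.1 y, 0) - J n (projPoint hL q.1 q.pos, 0) -
      inner ℝ (gradPart T L (J n) q) (y - q.pos)‖ ≤
      (ε + 2 * ‖gradPart T L (J n) - gradPart T L g‖) * ‖y - q.pos‖ := by
    intro n
    have hder : ∀ z ∈ square L ∩ Metric.ball q.pos r,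
        HasFDerivWithinAt (fun y => J n (projPoint hL q.1 y, 0))
        (InnerProductSpace.toDual ℝ Plane (gradPart T L (J n) (projPoint hL q.1 z)))
        (square L ∩ Metric.ball q.pos r) z := by
      intro z hz
      have h1 := hJ n (projPoint hL q.1 z)
      rw [pos_projPoint hL q.1 hz.1] at h1
      exact (hasGradientWithinAt_iff_hasFDerivWithinAt.1 h1).mono inter_subset_left
    refine Convex.norm_image_sub_le_of_norm_hasFDerivWithin_le' hder
      (φ := InnerProductSpace.toDual ℝ Plane (gradPart T L (J n) q)) (fun z hz => ?_) hconv hxs hy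
    rw [← map_sub, LinearIsometryEquiv.norm_map]
    have h1 : ‖gradPart T L g (projPoint hL q.1 z) - gradPart T L g q‖ < ε := by
      have := hrε (Metric.mem_ball.1 hz.2)
      rwa [projPoint_pos, dist_eq_norm] at this
    have h2 := (gradPart T L (J n) - gradPart T L g).norm_coe_le_norm (projPoint hL q.1 z)
    have h3 := (gradPart T L (J n) - gradPart T L g).norm_coe_le_norm q
    rw [ContinuousMap.sub_apply] at h2 h3
    have e : gradPart T L (J n) (projPoint hL q.1 z) - gradPart T L (J n) q =
        (gradPart T L (J n) (projPoint hL q.1 z) - gradPart T L g (projPoint hL q.1 z)) -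
        (gradPart T L (J n) q - gradPart T L g q) +
        (gradPart T L g (projPoint hL q.1 z) - gradPart T L g q) := by abel
    rw [e]
    refine (norm_add_le _ _).trans ?_
    have := norm_sub_le (gradPart T L (J n) (projPoint hL q.1 z) - gradPart T L g
      (projPoint hL q.1 z)) (gradPart T L (J n) q - gradPart T L g q)
    linarith
  have hev : ∀ p, Tendsto (fun n => J n p) atTop (𝓝 (g p)) := fun p => h.eval_const p
  have hG : Tendsto (fun n => gradPart T L (J n)) atTop (𝓝 (gradPart T L g)) :=
    ((gradPart T L).continuous.tendsto g).comp h
  refine le_of_tendsto_of_tendsto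
    (((hev _).sub (hev _)).sub ((hG.eval_const q).inner tendsto_const_nhds)).norm
    (?_ : Tendsto _ _ (𝓝 (ε * ‖y - q.pos‖))) (Eventually.of_forall key)
  have := (((tendsto_iff_norm_sub_tendsto_zero.1 hG).const_mul 2).const_add ε).mul_const
    ‖y - q.pos‖
  simpa using this

theorem isJet_sum_fieldMode {Ω : Type*} (β : Freq → ℝ≥0 → Ω → ℝ) {L T : ℝ} (hL : 0 ≤ L)
    (a : Freq → ℝ) (F : Finset Freq) (ω : Ω) :
    IsJet hL (∑ k ∈ F, fieldMode β L T (a k) k ω) := by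
  intro q
  rw [hasGradientWithinAt_iff_hasFDerivWithinAt]
  have h1 : HasFDerivAt (fun y => ∑ k ∈ F, (a k * modePath β L k ω q.1) * basis2D L k y)
      (∑ k ∈ F, (a k * modePath β L k ω q.1) • InnerProductSpace.toDual ℝ Plane
        !₂[basisJet L k 1 (q.pos 0) (q.pos 1), basisJet L k 2 (q.pos 0) (q.pos 1)]) q.pos :=
    HasFDerivAt.fun_sum fun k _ =>
      ((hasGradientAt_basis2D L k q.pos).hasFDerivAt).const_mul _
  have h2 : (∑ k ∈ F, (a k * modePath β L k ω q.1) • InnerProductSpace.toDual ℝ Plane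
        !₂[basisJet L k 1 (q.pos 0) (q.pos 1), basisJet L k 2 (q.pos 0) (q.pos 1)]) =
      InnerProductSpace.toDual ℝ Plane
        (gradPart T L (∑ k ∈ F, fieldMode β L T (a k) k ω) q) := by
    ext v
    simp [gradPart_apply, PiLp.inner_apply, Fin.sum_univ_two, fieldMode, SpaceTime.pos,
      ContinuousMap.coe_sum, Finset.sum_add_distrib, mul_add]
    congr 1 <;> exact Finset.sum_congr rfl fun k _ => by ring
  rw [h2] at h1
  have hy : ∀ y ∈ square L, (∑ k ∈ F, fieldMode β L T (a k) k ω) (projPoint hL q.1 y, 0) =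
      ∑ k ∈ F, (a k * modePath β L k ω q.1) * basis2D L k y := by
    intro y hy
    simp only [projPoint_eq hL q.1 hy, ContinuousMap.coe_sum, Finset.sum_apply]
    rfl
  exact h1.hasFDerivWithinAt.congr hy (hy _ (pos_mem_square q))

/-! ### Convergence of the series -/

/-- The Euclidean length dominates the sup norm, which reduces the claim to the two-dimensional
lattice sum used for Eisenstein series. -/
theorem summable_freqNorm_rpow {r : ℝ} (hr : 2 < r) : Summable fun k : Freq => freqNorm k ^ (-r) := by
  let i : Freq → (Fin 2 → ℤ) := fun k => ![k.1.1, k.1.2]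
  have hi : Function.Injective i := by
    intro k l h
    have h0 := congrFun h 0
    have h1 := congrFun h 1
    exact Subtype.ext (Prod.ext h0 h1)
  refine ((EisensteinSeries.summable_one_div_norm_rpow hr).comp_injective hi).of_nonneg_of_le
    (fun k => Real.rpow_nonneg (Real.sqrt_nonneg _) _) fun k => ?_
  have hpos : 0 < ‖i k‖ := by
    rw [norm_pos_iff]
    intro h
    have h0 := congrFun h 0
    have h1 := congrFun h 1
    exact k.2 (Prod.ext h0 h1)
  refine Real.rpow_le_rpow_of_nonpos hpos ?_ (by linarith)
  refine (pi_norm_le_iff_of_nonneg (Real.sqrt_nonneg _)).2 ?_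
  intro j
  fin_cases j
  · exact (Int.norm_eq_abs _).trans_le (abs_fst_le_freqNorm k)
  · exact (Int.norm_eq_abs _).trans_le (abs_snd_le_freqNorm k)

theorem IsNoiseRegularization.exists_summable {α : ℝ → Freq → ℝ} (hα : IsNoiseRegularization α)
    {L ε : ℝ} (hL : 0 < L) (hε : 0 < ε) : ∃ δ : ℝ, 0 < δ ∧ δ < 1 / 4 ∧
      Summable fun k => α ε k ^ 2 * eigenvalue L k ^ (4 * δ - 1) := by
  obtain ⟨d, hd, K, hK⟩ := hα.decay ε hε
  have hm0 : 0 < min d 1 := lt_min hd one_pos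
  have hm1 : min d 1 ≤ 1 := min_le_right _ _
  have hmd : min d 1 ≤ d := min_le_left _ _
  -- The general term is of order |k|^(-2d + 8δ - 2), and 8δ ≤ d makes this at most |k|^(-2-d). The
  -- minimum with 1 keeps δ below 1/4.
  refine ⟨min d 1 / 8, by linarith, by linarith, ?_⟩
  set δ := min d 1 / 8 with hδ
  set w := 2 * Real.pi / L with hw
  have hw0 : 0 < w := by have := Real.pi_pos; positivity
  refine ((summable_freqNorm_rpow (r := 2 + d) (by linarith)).mul_left
    (K ^ 2 * (w ^ 2) ^ (4 * δ - 1))).of_nonneg_of_le (fun k => ?_) fun k => ?_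
  · have := eigenvalue_pos hL k
    positivity
  · have hκ := one_le_freqNorm k
    have hμ : eigenvalue L k = w ^ 2 * freqNorm k ^ 2 := by rw [eigenvalue, hw]; ring
    have h1 : α ε k ^ 2 ≤ K ^ 2 * (freqNorm k ^ (-d)) ^ 2 := by
      rw [← sq_abs, ← mul_pow]
      gcongr
      exact hK k
    have h2 : (freqNorm k ^ (-d)) ^ 2 * (freqNorm k ^ 2) ^ (4 * δ - 1) ≤
        freqNorm k ^ (-(2 + d)) := by
      rw [← Real.rpow_natCast, ← Real.rpow_natCast, ← Real.rpow_mul (by positivity),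
        ← Real.rpow_mul (by positivity), ← Real.rpow_add (by positivity)]
      refine Real.rpow_le_rpow_of_exponent_le hκ ?_
      push_cast
      rw [hδ]
      linarith
    rw [hμ, Real.mul_rpow (by positivity) (by positivity)]
    calc _ ≤ K ^ 2 * (freqNorm k ^ (-d)) ^ 2 *
          ((w ^ 2) ^ (4 * δ - 1) * (freqNorm k ^ 2) ^ (4 * δ - 1)) := by gcongr
      _ = K ^ 2 * (w ^ 2) ^ (4 * δ - 1) *
          ((freqNorm k ^ (-d)) ^ 2 * (freqNorm k ^ 2) ^ (4 * δ - 1)) := by ring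
      _ ≤ _ := by gcongr

theorem ofReal_sqrt_sum_le_tsum {ι : Type*} (v : ι → ℝ) (F : Finset ι) (hv : ∀ k, 0 ≤ v k) :
    ENNReal.ofReal √(∑ k ∈ F, v k) ≤ (∑' k, ENNReal.ofReal (v k)) ^ (1 / 2 : ℝ) := by
  rw [Real.sqrt_eq_rpow, ← ENNReal.ofReal_rpow_of_nonneg (Finset.sum_nonneg fun k _ => hv k)
    (by norm_num), ENNReal.ofReal_sum_of_nonneg fun k _ => hv k]
  gcongr
  exact ENNReal.sum_le_tsum _

/-! ### The limiting random field -/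

/-- Applied to finite sets of modes disjoint from a large one, the bound on partial sums is Cauchy's
criterion for unconditional convergence in the complete space L²(Ω; C(K)). -/
theorem exists_field {Ω : Type*} [MeasurableSpace Ω] {P : Measure Ω} {β : Freq → ℝ≥0 → Ω → ℝ}
    (hβ : ∀ k, IsBrownianReal (β k) P) (hind : iIndepFun (fun k ω t => β k t ω) P) {L T δ : ℝ}
    (hL : 0 < L) (hT : 0 < T) (h0 : 0 < δ) (h1 : δ < 1 / 4) {a : Freq → ℝ}
    (ha : Summable fun k => a k ^ 2 * eigenvalue L k ^ (4 * δ - 1)) :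
    ∃ f : Ω → C(SpaceTime T L × Fin 3, ℝ), MemLp f 2 P ∧
      Tendsto (fun F : Finset Freq =>
        eLpNorm (fun ω => (∑ k ∈ F, fieldMode β L T (a k) k ω) - f ω) 2 P) atTop (𝓝 0) := by
  obtain ⟨C, hC⟩ := exists_field_bound hL hT h0 h1 (p := 2) (by norm_num)
  have hC' := hC Ω P β hβ hind a
  rw [ENNReal.ofReal_ofNat] at hC'
  have hmem : ∀ F : Finset Freq, MemLp (fun ω => ∑ k ∈ F, fieldMode β L T (a k) k ω) 2 P :=
    fun F => ⟨aestronglyMeasurable_sum_fieldMode hβ hL hT a F, (hC' F).trans_lt (by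
      exact ENNReal.mul_lt_top ENNReal.coe_lt_top ENNReal.ofReal_lt_top)⟩
  have hX : ∀ k, MemLp (fun ω => fieldMode β L T (a k) k ω) 2 P := fun k => by
    simpa using hmem {k}
  have hsum : ∀ F : Finset Freq, ∑ k ∈ F, (hX k).toLp = (hmem F).toLp := by
    intro F
    induction F using Finset.cons_induction with
    | empty => simp; rfl
    | cons k F hk ih =>
      rw [Finset.sum_cons, ih, ← MemLp.toLp_add]
      congr 1
      ext1 ω
      exact (Finset.sum_cons (f := fun k => fieldMode β L T (a k) k ω) hk).symm
  have hs : Summable fun k => (hX k).toLp := by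
    rw [summable_iff_vanishing_norm]
    intro ε hε
    have hη : 0 < (ε / (C + 1)) ^ 2 := by positivity
    obtain ⟨s, hs⟩ := summable_iff_vanishing_norm.1 ha _ hη
    refine ⟨s, fun F hF => ?_⟩
    have h3 := hs F hF
    have h4 : √(∑ k ∈ F, a k ^ 2 * eigenvalue L k ^ (4 * δ - 1)) < ε / (C + 1) := by
      rw [Real.sqrt_lt' (by positivity)]
      exact (le_abs_self _).trans_lt h3
    rw [hsum, Lp.norm_toLp]
    have h5 := ENNReal.toReal_mono (by
      exact (ENNReal.mul_lt_top ENNReal.coe_lt_top ENNReal.ofReal_lt_top).ne) (hC' F)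
    rw [ENNReal.toReal_mul, ENNReal.coe_toReal, ENNReal.toReal_ofReal (Real.sqrt_nonneg _)] at h5
    refine h5.trans_lt ?_
    rw [lt_div_iff₀ (by positivity)] at h4
    nlinarith [Real.sqrt_nonneg (∑ k ∈ F, a k ^ 2 * eigenvalue L k ^ (4 * δ - 1))]
  obtain ⟨f, hf⟩ := hs
  refine ⟨f, Lp.memLp f, ?_⟩
  have h6 : Tendsto (fun F : Finset Freq => (hmem F).toLp) atTop (𝓝 f) := by
    simp_rw [← hsum]
    exact hf
  rw [← Lp.toLp_coeFn f (Lp.memLp f), Lp.tendsto_Lp_iff_tendsto_eLpNorm''] at h6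
  exact h6

/-- A pathwise regular version of the stochastic convolution and its derivatives. -/
theorem exists_regular_field {Ω : Type*} [MeasurableSpace Ω] {P : Measure Ω}
    {β : Freq → ℝ≥0 → Ω → ℝ} (hβ : ∀ k, IsBrownianReal (β k) P)
    (hind : iIndepFun (fun k ω t => β k t ω) P) {L T δ : ℝ}
    (hL : 0 < L) (hT : 0 < T) (h0 : 0 < δ) (h1 : δ < 1 / 4) {a : Freq → ℝ}
    (ha : Summable fun k => a k ^ 2 * eigenvalue L k ^ (4 * δ - 1)) :
    ∃ f : Ω → C(SpaceTime T L × Fin 3, ℝ), MemLp f 2 P ∧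
      Tendsto (fun F : Finset Freq =>
        eLpNorm (fun ω => (∑ k ∈ F, fieldMode β L T (a k) k ω) - f ω) 2 P) atTop (𝓝 0) ∧
      (∀ ω, IsJet hL.le (f ω)) ∧
      ∀ (p : ℝ≥0∞) (C : ℝ≥0∞), (∀ F : Finset Freq,
        eLpNorm (fun ω => ∑ k ∈ F, fieldMode β L T (a k) k ω) p P ≤ C) → eLpNorm f p P ≤ C := by
  classical
  obtain ⟨f, hf, hlim⟩ := exists_field hβ hind hL hT h0 h1 ha
  obtain ⟨F, hF⟩ := exists_seq_tendsto (atTop : Filter (Finset Freq))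
  obtain ⟨φ, hφ, hae⟩ := (tendstoInMeasure_of_tendsto_eLpNorm (by norm_num)
    (fun n => aestronglyMeasurable_sum_fieldMode hβ hL hT a (F n)) hf.aestronglyMeasurable
    (hlim.comp hF)).exists_seq_tendsto_ae
  -- Resetting the field to zero where the subsequence fails to converge uniformly makes it a jet
  -- for every ω, not merely almost every one.
  let f' : Ω → C(SpaceTime T L × Fin 3, ℝ) := fun ω =>
    if Tendsto (fun n => ∑ k ∈ F (φ n), fieldMode β L T (a k) k ω) atTop (𝓝 (f ω)) then f ω else 0
  have hff' : f =ᵐ[P] f' := by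
    filter_upwards [hae] with ω hω
    exact (if_pos hω).symm
  refine ⟨f', hf.ae_eq hff', hlim.congr fun F => eLpNorm_congr_ae ?_, fun ω => ?_,
    fun p C hC => ?_⟩
  · filter_upwards [hff'] with ω hω
    rw [hω]
  · by_cases h : Tendsto (fun n => ∑ k ∈ F (φ n), fieldMode β L T (a k) k ω) atTop (𝓝 (f ω))
    · simp only [f', if_pos h]
      exact isJet_of_tendsto hL.le (fun n => isJet_sum_fieldMode β hL.le a _ ω) h
    · simp only [f', if_neg h]
      simpa using isJet_sum_fieldMode (T := T) β hL.le a ∅ ω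
  -- Fatou along the subsequence, for arbitrary p and C: a single field inherits every uniform
  -- moment bound on the partial sums.
  · rw [← eLpNorm_congr_ae hff']
    refine (Lp.eLpNorm_lim_le_liminf_eLpNorm (fun n =>
      aestronglyMeasurable_sum_fieldMode hβ hL hT a (F (φ n))) f hae).trans ?_
    refine liminf_le_of_le (by isBoundedDefault) fun b hb => ?_
    obtain ⟨n, hn⟩ := hb.exists
    exact hn.trans (hC _)

/-! ### From the field to the gradient version and its moments -/

/-- Evaluation at a point, alone or after taking the gradient part, is continuous and linear on
C(K), so convergence in L²(Ω; C(K)) yields both pointwise series statements. -/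
theorem hasL2Sum_clm {Ω ι V E : Type*} [MeasurableSpace Ω] {P : Measure Ω}
    [NormedAddCommGroup V] [NormedSpace ℝ V] [NormedAddCommGroup E] [NormedSpace ℝ E]
    (Λ : V →L[ℝ] E) {S : ι → Ω → V} {f : Ω → V} {X : ι → Ω → E}
    (hX : ∀ k, MemLp (X k) 2 P) (hXS : ∀ k, X k =ᵐ[P] fun ω => Λ (S k ω)) (hf : MemLp f 2 P)
    (h : Tendsto (fun F : Finset ι => eLpNorm (fun ω => (∑ k ∈ F, S k ω) - f ω) 2 P) atTop (𝓝 0)) :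
    HasL2Sum P X fun ω => Λ (f ω) := by
  refine ⟨hX, Λ.comp_memLp' hf, ?_⟩
  have hlim := ENNReal.Tendsto.const_mul (a := (‖Λ‖₊ : ℝ≥0∞)) h (Or.inr ENNReal.coe_ne_top)
  rw [mul_zero] at hlim
  refine tendsto_of_tendsto_of_tendsto_of_le_of_le tendsto_const_nhds hlim (fun _ => zero_le)
    fun F => ?_
  have hae : ∀ᵐ ω ∂P, ∀ k ∈ F, X k ω = Λ (S k ω) := by
    rw [Filter.eventually_all_finset]
    exact fun k _ => hXS k
  have hle : ∀ᵐ ω ∂P, ‖(∑ k ∈ F, X k ω) - Λ (f ω)‖₊ ≤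
      ‖Λ‖₊ * ‖(∑ k ∈ F, S k ω) - f ω‖₊ := by
    filter_upwards [hae] with ω hω
    rw [Finset.sum_congr rfl hω, ← map_sum, ← map_sub]
    exact Λ.le_opNNNorm _
  exact eLpNorm_le_nnreal_smul_eLpNorm_of_ae_le_mul hle 2

theorem isGradientVersion_of_field {Ω : Type*} [MeasurableSpace Ω] {P : Measure Ω}
    {β : Freq → ℝ≥0 → Ω → ℝ} (hβ : ∀ k, IsBrownianReal (β k) P) {L T : ℝ}
    (hL : 0 < L) (hT : 0 < T) {a : Freq → ℝ} {f : Ω → C(SpaceTime T L × Fin 3, ℝ)}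
    (hf : MemLp f 2 P) (hlim : Tendsto (fun F : Finset Freq =>
        eLpNorm (fun ω => (∑ k ∈ F, fieldMode β L T (a k) k ω) - f ω) 2 P) atTop (𝓝 0))
    (hjet : ∀ ω, IsJet hL.le (f ω)) :
    IsGradientVersion P β a T L
      (fun t x ω => f ω (projPoint hL.le (projIcc 0 T hT.le t) x, 0))
      fun ω => gradPart T L (f ω) := by
  refine ⟨fun t ht x hx => ?_, fun ω => ?_, fun ω q => ?_, fun q => ?_⟩
  · refine hasL2Sum_clm (ContinuousMap.evalCLM ℝ (projPoint hL.le (projIcc 0 T hT.le t) x, 0))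
      (S := fun k => fieldMode β L T (a k) k) (fun k => ?_) (fun k => ?_) hf hlim
    · have := ((memLp_modeConvolution hβ L k t.toNNReal).const_mul (a k)).mul_const (basis2D L k x)
      exact this
    · filter_upwards [fieldMode_ae_eq hβ L T (a k) k
        (projPoint hL.le (projIcc 0 T hT.le t) x, 0)] with ω hω
      rw [ContinuousMap.evalCLM_apply, hω, projPoint_eq hL.le _ hx, projIcc_of_mem hT.le ht]
      simp only [basisJet, basis2D]
      ring
  · refine Continuous.continuousOn ?_
    refine (f ω).continuous.comp (Continuous.prodMk ?_ continuous_const)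
    have h : Continuous fun q : ℝ × Plane => (projIcc 0 T hT.le q.1, q.2) :=
      (continuous_projIcc.comp continuous_fst).prodMk continuous_snd
    exact (continuous_projPoint hL.le).comp h
  · have := hjet ω q
    have e : projIcc 0 T hT.le q.time = q.1 := projIcc_val hT.le q.1
    simpa only [e] using this
  · refine hasL2Sum_clm ((ContinuousMap.evalCLM ℝ q).comp (gradPart T L))
      (S := fun k => fieldMode β L T (a k) k) (fun k => ?_) (fun k => ?_) hf hlim
    · have := ((memLp_modeConvolution hβ L k q.time.toNNReal).const_mul (a k))
      exact (ContinuousLinearMap.toSpanSingleton ℝ (gradient (basis2D L k) q.pos)).comp_memLp' this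
    · filter_upwards [fieldMode_ae_eq hβ L T (a k) k (q, 1),
        fieldMode_ae_eq hβ L T (a k) k (q, 2)] with ω h1 h2
      rw [(hasGradientAt_basis2D L k q.pos).gradient]
      simp only [ContinuousLinearMap.comp_apply, ContinuousMap.evalCLM_apply, gradPart_apply, h1,
        h2]
      ext i
      fin_cases i <;> simp [SpaceTime.pos, SpaceTime.time] <;> ring

/-- The factor 2 bounds the norm of the map `gradPart`; adding 1 keeps the constant positive even
when C = 0. -/
theorem lintegral_gradPart_le {Ω : Type*} [MeasurableSpace Ω] {P : Measure Ω} {L T p : ℝ}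
    (hp : 1 ≤ p) {f : Ω → C(SpaceTime T L × Fin 3, ℝ)} {C : ℝ≥0} {S : ℝ≥0∞}
    (hf : eLpNorm f (ENNReal.ofReal p) P ≤ C * S ^ (1 / 2 : ℝ)) :
    ∫⁻ ω, ‖gradPart T L (f ω)‖ₑ ^ p ∂P ≤ ENNReal.ofReal ((2 * C) ^ p + 1) * S ^ (p / 2) := by
  have hp0 : 0 < p := by linarith
  have h1 : eLpNorm (fun ω => gradPart T L (f ω)) (ENNReal.ofReal p) P ≤
      2 * eLpNorm f (ENNReal.ofReal p) P := by
    have hle : ∀ᵐ ω ∂P, ‖gradPart T L (f ω)‖₊ ≤ 2 * ‖f ω‖₊ :=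
      Eventually.of_forall fun ω => norm_gradPart_le (f ω)
    exact eLpNorm_le_nnreal_smul_eLpNorm_of_ae_le_mul hle _
  have h2 := h1.trans (mul_le_mul_right hf 2)
  rw [eLpNorm_eq_eLpNorm' (by simpa using hp0) ENNReal.ofReal_ne_top,
    ENNReal.toReal_ofReal hp0.le, eLpNorm', one_div, ENNReal.rpow_inv_le_iff hp0] at h2
  refine h2.trans ?_
  rw [← mul_assoc, ENNReal.mul_rpow_of_nonneg _ _ hp0.le, ← ENNReal.rpow_mul]
  have e : (1 / 2 : ℝ) * p = p / 2 := by ring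
  rw [e]
  gcongr
  have e2 : (2 * C : ℝ≥0∞) = ENNReal.ofReal (2 * C) := by
    rw [ENNReal.ofReal_mul (by norm_num)]; simp
  rw [e2, ENNReal.ofReal_rpow_of_nonneg (by positivity) hp0.le]
  exact ENNReal.ofReal_le_ofReal (by linarith)

/-- The constants of the moment bound, chosen for all exponents at once. -/
theorem exists_uniform_field_bound {L T : ℝ} (hL : 0 < L) (hT : 0 < T) :
    ∃ C : ℝ → ℝ → ℝ≥0, ∀ p δ : ℝ, 1 ≤ p → 0 < δ → δ < 1 / 4 →
      ∀ (Ω : Type*) [MeasurableSpace Ω] (P : Measure Ω) (β : Freq → ℝ≥0 → Ω → ℝ),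
      (∀ k, IsBrownianReal (β k) P) → iIndepFun (fun k ω t => β k t ω) P →
      ∀ (a : Freq → ℝ) (F : Finset Freq),
        eLpNorm (fun ω => ∑ k ∈ F, fieldMode β L T (a k) k ω) (ENNReal.ofReal p) P ≤
          C p δ * ENNReal.ofReal √(∑ k ∈ F, a k ^ 2 * eigenvalue L k ^ (4 * δ - 1)) := by
  -- Outside the admissible range of p and δ the constant is set to the irrelevant value 0.
  refine ⟨fun p δ => if h : 1 ≤ p ∧ 0 < δ ∧ δ < 1 / 4 then
    (exists_field_bound hL hT h.2.1 h.2.2 h.1).choose else 0, fun p δ hp h0 h1 => ?_⟩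
  simp only [dif_pos (And.intro hp (And.intro h0 h1))]
  exact (exists_field_bound hL hT h0 h1 hp).choose_spec

end SurfaceGrowth

end

theorem mainTheorem7 (L T : ℝ) (hL : 0 < L) (hT : 0 < T) :
    ∃ C : ℝ → ℝ → ℝ, (∀ p δ, 0 < C p δ) ∧
      ∀ (Ω : Type*) [MeasurableSpace Ω] (P : Measure Ω) [IsProbabilityMeasure P]
        (β : SurfaceGrowth.Freq → ℝ≥0 → Ω → ℝ),
        (∀ k, IsBrownianReal (β k) P) → iIndepFun (fun k ω t => β k t ω) P →
        ∀ α : ℝ → SurfaceGrowth.Freq → ℝ, SurfaceGrowth.IsNoiseRegularization α →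
        ∀ ε : ℝ, 0 < ε →
        ∃ (Z : ℝ → SurfaceGrowth.Plane → Ω → ℝ)
          (G : Ω → C(SurfaceGrowth.SpaceTime T L, SurfaceGrowth.Plane)),
          SurfaceGrowth.IsGradientVersion P β (α ε) T L Z G ∧
          ∀ p : ℝ, 1 ≤ p →
            MemLp G (ENNReal.ofReal p) P ∧
            ∀ δ : ℝ, 0 < δ → δ < 1 / 4 →
              ∫⁻ ω, ‖G ω‖ₑ ^ p ∂P ≤
                ENNReal.ofReal (C p δ) *
                  (∑' k : SurfaceGrowth.Freq,
                    ENNReal.ofReal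
                      (α ε k ^ 2 * SurfaceGrowth.eigenvalue L k ^ (4 * δ - 1))) ^ (p / 2) := by
  obtain ⟨C, hC⟩ := SurfaceGrowth.exists_uniform_field_bound hL hT
  refine ⟨fun p δ => (2 * C p δ : ℝ) ^ p + 1, fun p δ => by positivity,
    fun Ω _ P _ β hβ hind α hα ε hε => ?_⟩
  -- This exponent serves only to construct the field and to show that its moments are finite; the
  -- estimate itself holds for every δ, including those for which the sum diverges.
  obtain ⟨δ₀, h0, h1, hs⟩ := hα.exists_summable hL hε
  have hnn : ∀ (δ : ℝ) k, 0 ≤ α ε k ^ 2 * SurfaceGrowth.eigenvalue L k ^ (4 * δ - 1) := fun δ k => by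
    have := SurfaceGrowth.eigenvalue_pos hL k
    positivity
  obtain ⟨f, hf, hlim, hjet, hbound⟩ :=
    SurfaceGrowth.exists_regular_field hβ hind hL hT h0 h1 hs
  have hfp : ∀ p δ : ℝ, 1 ≤ p → 0 < δ → δ < 1 / 4 → eLpNorm f (ENNReal.ofReal p) P ≤
      C p δ * (∑' k : SurfaceGrowth.Freq, ENNReal.ofReal
        (α ε k ^ 2 * SurfaceGrowth.eigenvalue L k ^ (4 * δ - 1))) ^ (1 / 2 : ℝ) := by
    intro p δ hp hδ0 hδ1
    refine hbound _ _ fun F => (hC p δ hp hδ0 hδ1 Ω P β hβ hind (α ε) F).trans ?_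
    gcongr
    exact SurfaceGrowth.ofReal_sqrt_sum_le_tsum _ F (hnn δ)
  refine ⟨_, _, SurfaceGrowth.isGradientVersion_of_field hβ hL hT hf hlim hjet,
    fun p hp => ⟨?_, fun δ hδ0 hδ1 => SurfaceGrowth.lintegral_gradPart_le hp
      (hfp p δ hp hδ0 hδ1)⟩⟩
  refine (SurfaceGrowth.gradPart T L).comp_memLp' ⟨hf.aestronglyMeasurable, ?_⟩
  refine (hfp p δ₀ hp h0 h1).trans_lt (ENNReal.mul_lt_top ENNReal.coe_lt_top ?_)
  exact ENNReal.rpow_lt_top_of_nonneg (by norm_num) hs.tsum_ofReal_ne_top
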